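/- **Theorem.** Every $\mathsf{PLS}$-complete search problem is (traditionally) downward self-reducible if and only if $\mathsf{PLS}=\mathsf{FP}$. Here the notions are as follows. * A *search problem* is a relation $\mathcal R\subseteq\{0,1\}^*\times\{0,1\}^*$; $y$ is a solution to $x$ if $(x,y)\in\mathcal R$. $\mathsf{TFNP}$ is the class of search problems that are total (every $x$ has a solution), polynomially bounded ($|y|\le \mathrm{poly}(|x|)$ for all $(x,y)\in\mathcal R$) and decidable in time polynomial in $|x|+|y|$. * A *many-to-one reduction* from $\mathcal R$ to $\mathcal Q$ is a pair $f,g$ of polynomial-time computable functions on $\{0,1\}^*$ such that, for every instance $x$ of $\mathcal R$ that has a solution and every $y$, $(f(x),y)\in\mathcal Q$ implies $(x,g(y))\in\mathcal R$. * *Sink-of-DAG*: given Boolean circuits $S,V:\{0,1\}^n\to\{0,1\}^n$ with $S(0^n)\ne 0^n$, find $v\in\{0,1\}^n$ such that $S(v)\neq v$ and either $S(S(v))=S(v)$ or $V(S(v))\le V(v)$ (values of $V$ are read as binary numbers). Strings that do not encode such a pair of circuits have a fixed default answer $\bot$ as their only solution, so that the problem is total. * $\mathsf{PLS}$ is the class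 of all $\mathsf{TFNP}$ problems that have a many-to-one reduction to Sink-of-DAG. A problem is *$\mathsf{PLS}$-complete* if it is in $\mathsf{PLS}$ and every problem in $\mathsf{PLS}$ has a many-to-one reduction to it. * $\mathsf{FP}$ is the class of all $\mathsf{TFNP}$ problems $\mathcal R$ that have a polynomial-time algorithm, i.e. a polynomial-time computable $A$ with $(x,A(x))\in\mathcal R$ for all $x$. * A total search problem $\mathcal R$ is *(traditionally) downward self-reducible* if there is a deterministic polynomial-time oracle algorithm that, on every input $x$ and with every oracle $O$ satisfying $(q,O(q))\in\mathcal R$ for all $q$, outputs a solution to $x$ and makes only queries $q$ with $|q|<|x|$. -/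

import Mathlib

/-! ### Machine model

Multi-stack machines with structured control, over the alphabet `{0,1}`.  A machine has finitely many
stacks (two stacks make one Turing tape, so these are multitape Turing machines up to a constant
factor in time), and every primitive step pushes, pops or inspects one single bit.  An oracle query
is charged one step plus the length of the query string; the answer then appears in one step. -/

/-- Bit strings, the elements of `{0,1}*`. -/
abbrev Str := List Bool

/-- Programs.  The stacks are numbered by natural numbers; a program mentions only finitely many. -/
inductive Cmd : Type
  | skip : Cmd
  | push (b : Bool) (r : ℕ) : Cmd
  | pop (r : ℕ) : Cmd
  /-- Branch on stack `r`: it is empty, its top is `0`, or its top is `1`. -/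
  | branch (r : ℕ) (cEmpty cZero cOne : Cmd) : Cmd
  | seq (c d : Cmd) : Cmd
  /-- Repeat the body as long as stack `r` is nonempty. -/
  | loop (r : ℕ) (body : Cmd) : Cmd
  /-- Ask the oracle for the content of stack `src`, and put the answer on stack `dst`. -/
  | query (src dst : ℕ) : Cmd

/-- The contents of all stacks; the head of a list is the top of the stack. -/
abbrev Store := ℕ → Str

/-- The initial store: the inputs are on stacks `0, 1, …`, and all other stacks are empty. -/
def Store.input (l : List Str) : Store := fun r => l.getD r []

/-- `Exec O c σ σ' t qs`: started on the store `σ` with the oracle `O`, the program `c` halts with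
store `σ'` after exactly `t` steps, and `qs` is the list of the queries it has asked. -/
inductive Exec (O : Str → Str) : Cmd → Store → Store → ℕ → List Str → Prop
  | skip (σ : Store) : Exec O Cmd.skip σ σ 1 []
  | push (b : Bool) (r : ℕ) (σ : Store) :
      Exec O (Cmd.push b r) σ (Function.update σ r (b :: σ r)) 1 []
  | pop (r : ℕ) (σ : Store) :
      Exec O (Cmd.pop r) σ (Function.update σ r (σ r).tail) 1 []
  | branch_empty {r : ℕ} {c₁ c₂ c₃ : Cmd} {σ σ' : Store} {t : ℕ} {qs : List Str} :
      σ r = [] → Exec O c₁ σ σ' t qs → Exec O (Cmd.branch r c₁ c₂ c₃) σ σ' (t + 1) qs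
  | branch_zero {r : ℕ} {c₁ c₂ c₃ : Cmd} {σ σ' : Store} {t : ℕ} {qs : List Str} {w : Str} :
      σ r = false :: w → Exec O c₂ σ σ' t qs → Exec O (Cmd.branch r c₁ c₂ c₃) σ σ' (t + 1) qs
  | branch_one {r : ℕ} {c₁ c₂ c₃ : Cmd} {σ σ' : Store} {t : ℕ} {qs : List Str} {w : Str} :
      σ r = true :: w → Exec O c₃ σ σ' t qs → Exec O (Cmd.branch r c₁ c₂ c₃) σ σ' (t + 1) qs
  | seq {c d : Cmd} {σ σ' σ'' : Store} {t t' : ℕ} {qs qs' : List Str} :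
      Exec O c σ σ' t qs → Exec O d σ' σ'' t' qs' →
        Exec O (Cmd.seq c d) σ σ'' (t + t' + 1) (qs ++ qs')
  | loop_done {r : ℕ} {c : Cmd} {σ : Store} :
      σ r = [] → Exec O (Cmd.loop r c) σ σ 1 []
  | loop_step {r : ℕ} {c : Cmd} {σ σ' σ'' : Store} {t t' : ℕ} {qs qs' : List Str} :
      σ r ≠ [] → Exec O c σ σ' t qs → Exec O (Cmd.loop r c) σ' σ'' t' qs' →
        Exec O (Cmd.loop r c) σ σ'' (t + t' + 1) (qs ++ qs')
  | query (src dst : ℕ) (σ : Store) :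
      Exec O (Cmd.query src dst) σ (Function.update σ dst (O (σ src)))
        (1 + (σ src).length) [σ src]

/-- On the given inputs, the program `c` halts in `t` steps with `out` on stack `0`, without asking
any query (so that the oracle, here constantly the empty string, plays no role). -/
def Computes (c : Cmd) (inputs : List Str) (out : Str) (t : ℕ) : Prop :=
  ∃ σ : Store, Exec (fun _ => []) c (Store.input inputs) σ t [] ∧ σ 0 = out

/-- `f : {0,1}* → {0,1}*` is computable in polynomial time. -/
def PolyTimeFun (f : Str → Str) : Prop :=
  ∃ (c : Cmd) (p : Polynomial ℕ), ∀ x : Str,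
    ∃ t : ℕ, Computes c [x] (f x) t ∧ t ≤ p.eval x.length

/-- The binary relation `R` is decidable in polynomial time (accepting is leaving the string `1`). -/
def PolyTimeRel (R : Str → Str → Prop) : Prop :=
  ∃ (c : Cmd) (p : Polynomial ℕ), ∀ x y : Str,
    ∃ (out : Str) (t : ℕ), Computes c [x, y] out t ∧ t ≤ p.eval (x.length + y.length) ∧
      (R x y ↔ out = [true])

/-! ### Search problems -/

/-- A search problem: `R x y` says that `y` is a solution to the instance `x`. -/
abbrev SearchProblem := Str → Str → Prop

/-- The instances that have a solution (the promise of `R`). -/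
def SearchProblem.dom (R : SearchProblem) : Set Str := {x | ∃ y, R x y}

/-- The completion of `R`: instances without a solution get the default answer `⊥`, here the empty
string, as their only solution. -/
def SearchProblem.completion (R : SearchProblem) : SearchProblem :=
  fun x y => R x y ∨ (x ∉ R.dom ∧ y = [])

/-- The class TFNP. -/
def TFNP : Set SearchProblem :=
  {R | (∀ x, ∃ y, R x y) ∧
    (∃ p : Polynomial ℕ, ∀ x y, R x y → y.length ≤ p.eval x.length) ∧
    PolyTimeRel R}

/-- Many-to-one reductions between search problems. -/
def SearchProblem.ReducesTo (R Q : SearchProblem) : Prop :=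
  ∃ f g : Str → Str, PolyTimeFun f ∧ PolyTimeFun g ∧
    ∀ x ∈ R.dom, ∀ y, Q (f x) y → R x (g y)

/-- `R` has a polynomial-time algorithm. -/
def SolvableInPolyTime (R : SearchProblem) : Prop :=
  ∃ A : Str → Str, PolyTimeFun A ∧ ∀ x ∈ R.dom, R x (A x)

/-- The total NP search problems that are solvable in polynomial time. -/
def FP : Set SearchProblem := {R | R ∈ TFNP ∧ SolvableInPolyTime R}

/-- `R` is (traditionally) downward self-reducible: a deterministic polynomial-time oracle algorithm
solves `R`, whatever solutions the oracle for `R` returns, and on an instance `x` all of its queries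
are instances that are strictly shorter than `x`. -/
def TraditionallyDSR (R : SearchProblem) : Prop :=
  ∃ (c : Cmd) (p : Polynomial ℕ),
    ∀ O : Str → Str, (∀ q, R.completion q (O q)) →
      ∀ x : Str, ∃ (σ : Store) (t : ℕ) (qs : List Str),
        Exec O c (Store.input [x]) σ t qs ∧ t ≤ p.eval x.length ∧
          (x ∈ R.dom → R x (σ 0) ∧ ∀ q ∈ qs, q ∈ R.dom ∧ q.length < x.length)

/-! ### Circuits and Sink-of-DAG -/

/-- A Boolean circuit over the basis NAND.  The wires are numbered `0, 1, 2, …`: first the inputs,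
then the gates, in order.  The gate `(i, j)` is the NAND of the wires `i` and `j`, and `outs` lists
the output wires.  A wire that does not exist (yet) is read as the constant `0`. -/
structure Circuit where
  gates : List (ℕ × ℕ)
  outs : List ℕ

/-- The values of all wires on the input `v`. -/
def Circuit.wires (C : Circuit) (v : Str) : Str :=
  C.gates.foldl (fun w g => w ++ [!(w.getD g.1 false && w.getD g.2 false)]) v

def Circuit.eval (C : Circuit) (v : Str) : Str :=
  C.outs.map fun i => (C.wires v).getD i false

/-- The number in `{0, …, 2^n - 1}` that a bit string of length `n` denotes (least significant bit
first). -/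
def Str.toNum (v : Str) : ℕ := Nat.ofDigits 2 (v.map Bool.toNat)

/-- A successor circuit and a value circuit. -/
structure DAGInstance where
  succ : Circuit
  val : Circuit

namespace DAGInstance

/-- The vertices are the bit strings of length `dim`. -/
def dim (I : DAGInstance) : ℕ := I.succ.outs.length

/-- The origin `0^n`. -/
def origin (I : DAGInstance) : Str := List.replicate I.dim false

/-- Both circuits have `n` outputs (they are evaluated on `n` inputs), and the origin is not a fixed
point of the successor map. -/
def Valid (I : DAGInstance) : Prop :=
  I.val.outs.length = I.dim ∧ I.succ.eval I.origin ≠ I.origin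

def IsSolution (I : DAGInstance) (v : Str) : Prop :=
  v.length = I.dim ∧ I.succ.eval v ≠ v ∧
    (I.succ.eval (I.succ.eval v) = I.succ.eval v ∨
      Str.toNum (I.val.eval (I.succ.eval v)) ≤ Str.toNum (I.val.eval v))

end DAGInstance

/-- Numbers are encoded in unary, `k ↦ 1^k 0`. -/
def encNat (k : ℕ) : Str := List.replicate k true ++ [false]

/-- A list is encoded by its items, each one preceded by the bit `1`, and a final bit `0`. -/
def encList {α : Type} (enc : α → Str) : List α → Str
  | [] => [false]
  | a :: l => true :: (enc a ++ encList enc l)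

def Circuit.encode (C : Circuit) : Str :=
  encList (fun g : ℕ × ℕ => encNat g.1 ++ encNat g.2) C.gates ++ encList encNat C.outs

def DAGInstance.encode (I : DAGInstance) : Str := I.succ.encode ++ I.val.encode

theorem encNat_append_inj {a b : ℕ} {s t : Str} (h : encNat a ++ s = encNat b ++ t) :
    a = b ∧ s = t := by
  induction a generalizing b with
  | zero => cases b <;> simp_all [encNat, List.replicate_succ]
  | succ a ih =>
    cases b with
    | zero => simp_all [encNat, List.replicate_succ]
    | succ b =>
      have := @ih b (by simpa [encNat, List.replicate_succ] using h)
      simpa using this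

theorem encList_append_inj {α : Type} {enc : α → Str}
    (he : ∀ a b s t, enc a ++ s = enc b ++ t → a = b ∧ s = t) :
    ∀ {l m : List α} {s t : Str}, encList enc l ++ s = encList enc m ++ t → l = m ∧ s = t
  | [], [], _, _, h => by simpa [encList] using h
  | [], _ :: _, _, _, h => by simp [encList] at h
  | _ :: _, [], _, _, h => by simp [encList] at h
  | a :: l, b :: m, s, t, h => by
    simp only [encList, List.cons_append, List.cons.injEq, true_and, List.append_assoc] at h
    obtain ⟨rfl, h'⟩ := he _ _ _ _ h
    obtain ⟨rfl, rfl⟩ := encList_append_inj he h'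
    exact ⟨rfl, rfl⟩

theorem Circuit.encode_append_inj {C D : Circuit} {s t : Str}
    (h : C.encode ++ s = D.encode ++ t) : C = D ∧ s = t := by
  cases C
  cases D
  simp only [Circuit.encode, List.append_assoc] at h
  obtain ⟨rfl, h'⟩ := encList_append_inj (fun a b s t hab => by
    simp only [List.append_assoc] at hab
    obtain ⟨h1, h2⟩ := encNat_append_inj hab
    obtain ⟨h3, h4⟩ := encNat_append_inj h2
    exact ⟨Prod.ext h1 h3, h4⟩) h
  obtain ⟨rfl, rfl⟩ := encList_append_inj (fun _ _ _ _ hab => encNat_append_inj hab) h'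
  exact ⟨rfl, rfl⟩

theorem DAGInstance.encode_injective : Function.Injective DAGInstance.encode := by
  intro I J h
  cases I
  cases J
  simp only [DAGInstance.encode] at h
  obtain ⟨rfl, h'⟩ := Circuit.encode_append_inj h
  obtain ⟨rfl, -⟩ := Circuit.encode_append_inj (s := []) (t := []) (by simpa using h')
  rfl

/-- Sink-of-DAG, as a total search problem: strings that do not encode a valid instance have the
default answer as their only solution. -/
def SinkOfDAG : SearchProblem :=
  SearchProblem.completion fun x v => ∃ I : DAGInstance, I.Valid ∧ x = I.encode ∧ I.IsSolution v

/-! ### The class PLS -/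

/-- The class PLS: the TFNP problems that are many-to-one reducible to Sink-of-DAG. -/
def PLS : Set SearchProblem := {R | R ∈ TFNP ∧ R.ReducesTo SinkOfDAG}

def PLSComplete (R : SearchProblem) : Prop :=
  R ∈ PLS ∧ ∀ Q ∈ PLS, Q.ReducesTo R

/-! ### Running programs -/

/-! If `PLS = FP`, a complete problem has a polynomial-time algorithm, which is a downward
self-reduction that asks no queries.

For the converse it suffices that one complete problem is solvable whenever it is downward
self-reducible. The problem chosen is `PaddedSink`: Sink-of-DAG with instances padded to lengths of
the form `2 ^ 2 ^ k`, every string of another length being void, with the trivial answer `[]`. It is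
complete, because padding at most squares the length, up to a constant (`paddedSink_plsComplete`). A
self-reduction on an input of length `n` asks only shorter queries; such a query is void or has
length at most `√n`, since of two different numbers `2 ^ 2 ^ k` the larger is at least the square of
the smaller (`mul_self_le_of_padLen`). Answering the queries recursively costs `T(n) ≤ p(n) * (C +
T(√n))`. If `p(n) * (C + 1) ≤ n ^ D`, then `T(n) ≤ n ^ (2 * D)` follows by induction, because `T(√n)
≤ n ^ D`. So the plain recursion is a polynomial-time algorithm (`solvableInPolyTime_of_dsr`), and
completeness carries it to all of PLS.

The recursion needs an oracle whose answers are the outputs of the self-reduction run with that same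
oracle. It is built length by length, which works because queries are shorter (`exists_selfOracle`).
An interpreter with an explicit stack of suspended calls executes the recursion; `Exec.reach` bounds
its steps and its space by the running time of the oracle program.

The remaining inclusion `FP ⊆ PLS` hides a computed solution `w` in an instance of Sink-of-DAG all
of whose solutions have tail `w` (`FP_subset_PLS`).

Everything rests on a calculus of polynomial-time functions between encoded types, `PT` and `PTP`,
whose main tools are case distinction and bounded iteration. -/

namespace Cmd

/-- Renaming of the stacks. -/
def ren (ρ : ℕ → ℕ) : Cmd → Cmd
  | skip => skip
  | push b r => push b (ρ r)
  | pop r => pop (ρ r)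
  | branch r c d e => branch (ρ r) (c.ren ρ) (d.ren ρ) (e.ren ρ)
  | seq c d => seq (c.ren ρ) (d.ren ρ)
  | loop r c => loop (ρ r) (c.ren ρ)
  | query s d => query (ρ s) (ρ d)

/-- A bound (strict) on the stacks that a program mentions. -/
def bound : Cmd → ℕ
  | skip => 0
  | push _ r => r + 1
  | pop r => r + 1
  | branch r c d e => max (r + 1) (max c.bound (max d.bound e.bound))
  | seq c d => max c.bound d.bound
  | loop r c => max (r + 1) c.bound
  | query s d => max (s + 1) (d + 1)

end Cmd

/-- A run consults the oracle only at its recorded queries. This makes query-free programs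
independent of the oracle, and later allows an oracle to be altered at strings that a run does not
ask. -/
theorem Exec.congr_oracle {O O' : Str → Str} {c : Cmd} {σ σ' : Store} {t : ℕ} {qs : List Str}
    (h : Exec O c σ σ' t qs) (hO : ∀ q ∈ qs, O q = O' q) : Exec O' c σ σ' t qs := by
  induction h with
  | skip σ => exact .skip σ
  | push b r σ => exact .push b r σ
  | pop r σ => exact .pop r σ
  | branch_empty h _ ih => exact .branch_empty h (ih hO)
  | branch_zero h _ ih => exact .branch_zero h (ih hO)
  | branch_one h _ ih => exact .branch_one h (ih hO)
  | seq _ _ ih ih' =>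
    exact .seq (ih fun q hq => hO q (by simp [hq])) (ih' fun q hq => hO q (by simp [hq]))
  | loop_done h => exact .loop_done h
  | loop_step h _ _ ih ih' =>
    exact .loop_step h (ih fun q hq => hO q (by simp [hq])) (ih' fun q hq => hO q (by simp [hq]))
  | query s d σ => rw [hO _ (by simp)]; exact .query s d σ

/-- The basis of subroutines: injectivity keeps distinct stacks distinct, and the caller's stacks
outside the range of `ρ` survive. -/
theorem Exec.rename {O : Str → Str} {c : Cmd} {σ σ' : Store} {t : ℕ} {qs : List Str}
    (h : Exec O c σ σ' t qs) {ρ : ℕ → ℕ} (hρ : Function.Injective ρ) :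
    ∀ τ : Store, (∀ r, τ (ρ r) = σ r) → ∃ τ' : Store, Exec O (c.ren ρ) τ τ' t qs ∧
      (∀ r, τ' (ρ r) = σ' r) ∧ ∀ s, s ∉ Set.range ρ → τ' s = τ s := by
  have upd : ∀ (τ σ : Store) (r : ℕ) (v : Str), (∀ r, τ (ρ r) = σ r) →
      (∀ s, Function.update τ (ρ r) v (ρ s) = Function.update σ r v s) ∧
      ∀ s, s ∉ Set.range ρ → Function.update τ (ρ r) v s = τ s := by
    intro τ σ r v h
    refine ⟨fun s => ?_, fun s hs => ?_⟩
    · by_cases hsr : s = r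
      · subst hsr; simp
      · rw [Function.update_of_ne hsr, Function.update_of_ne (hρ.ne hsr), h]
    · rw [Function.update_of_ne]
      rintro rfl
      exact hs ⟨r, rfl⟩
  induction h with
  | skip σ => exact fun τ h => ⟨τ, .skip τ, h, fun _ _ => rfl⟩
  | push b r σ =>
    intro τ h
    refine ⟨_, .push b (ρ r) τ, ?_⟩
    rw [h r]
    exact upd τ σ r _ h
  | pop r σ =>
    intro τ h
    refine ⟨_, .pop (ρ r) τ, ?_⟩
    rw [h r]
    exact upd τ σ r _ h
  | branch_empty hr _ ih =>
    intro τ h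
    obtain ⟨τ', h1, h2⟩ := ih τ h
    exact ⟨τ', .branch_empty ((h _).trans hr) h1, h2⟩
  | branch_zero hr _ ih =>
    intro τ h
    obtain ⟨τ', h1, h2⟩ := ih τ h
    exact ⟨τ', .branch_zero ((h _).trans hr) h1, h2⟩
  | branch_one hr _ ih =>
    intro τ h
    obtain ⟨τ', h1, h2⟩ := ih τ h
    exact ⟨τ', .branch_one ((h _).trans hr) h1, h2⟩
  | seq _ _ ih ih' =>
    intro τ h
    obtain ⟨τ', h1, h2, h3⟩ := ih τ h
    obtain ⟨τ'', h4, h5, h6⟩ := ih' τ' h2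
    exact ⟨τ'', .seq h1 h4, h5, fun s hs => (h6 s hs).trans (h3 s hs)⟩
  | loop_done hr => exact fun τ h => ⟨τ, .loop_done ((h _).trans hr), h, fun _ _ => rfl⟩
  | loop_step hr _ _ ih ih' =>
    intro τ h
    obtain ⟨τ', h1, h2, h3⟩ := ih τ h
    obtain ⟨τ'', h4, h5, h6⟩ := ih' τ' h2
    exact ⟨τ'', .loop_step (by rwa [h]) h1 h4, h5, fun s hs => (h6 s hs).trans (h3 s hs)⟩
  | query s d σ =>
    intro τ h
    refine ⟨_, ?_, upd τ σ d (O (σ s)) h⟩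
    rw [← h s]
    exact .query (ρ s) (ρ d) τ

theorem Exec.eq_of_bound_le {O : Str → Str} {c : Cmd} {σ σ' : Store} {t : ℕ} {qs : List Str}
    (h : Exec O c σ σ' t qs) : ∀ r, c.bound ≤ r → σ' r = σ r := by
  induction h with
  | skip σ => exact fun _ _ => rfl
  | push b r σ => intro s hs; rw [Function.update_of_ne]; simp only [Cmd.bound] at hs; omega
  | pop r σ => intro s hs; rw [Function.update_of_ne]; simp only [Cmd.bound] at hs; omega
  | branch_empty _ _ ih => intro s hs; exact ih s (by simp only [Cmd.bound] at hs; omega)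
  | branch_zero _ _ ih => intro s hs; exact ih s (by simp only [Cmd.bound] at hs; omega)
  | branch_one _ _ ih => intro s hs; exact ih s (by simp only [Cmd.bound] at hs; omega)
  | seq _ _ ih ih' =>
    intro s hs
    simp only [Cmd.bound] at hs
    exact (ih' s (by omega)).trans (ih s (by omega))
  | loop_done _ => exact fun _ _ => rfl
  | loop_step _ _ _ ih ih' =>
    intro s hs
    exact (ih' s hs).trans (ih s (by simp only [Cmd.bound] at hs; omega))
  | query s d σ => intro s hs; rw [Function.update_of_ne]; simp only [Cmd.bound] at hs; omega

/-- A step pushes at most one bit. Queries must be excluded, since an answer of any length arrives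
in a single step. -/
theorem Exec.length_le {O : Str → Str} {c : Cmd} {σ σ' : Store} {t : ℕ} {qs : List Str}
    (h : Exec O c σ σ' t qs) (hqs : qs = []) : ∀ r, (σ' r).length ≤ (σ r).length + t := by
  induction h with
  | skip σ => exact fun _ => Nat.le_add_right _ _
  | push b r σ =>
    intro s
    by_cases hs : s = r
    · subst hs; simp
    · rw [Function.update_of_ne hs]; omega
  | pop r σ =>
    intro s
    by_cases hs : s = r
    · subst hs; simp only [Function.update_self, List.length_tail]; omega
    · rw [Function.update_of_ne hs]; omega
  | branch_empty _ _ ih => intro s; have := ih hqs s; omega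
  | branch_zero _ _ ih => intro s; have := ih hqs s; omega
  | branch_one _ _ ih => intro s; have := ih hqs s; omega
  | seq _ _ ih ih' =>
    intro s
    have := ih (List.append_eq_nil_iff.1 hqs).1 s
    have := ih' (List.append_eq_nil_iff.1 hqs).2 s
    omega
  | loop_done _ => exact fun _ => Nat.le_add_right _ _
  | loop_step _ _ _ ih ih' =>
    intro s
    have := ih (List.append_eq_nil_iff.1 hqs).1 s
    have := ih' (List.append_eq_nil_iff.1 hqs).2 s
    omega
  | query s d σ => simp at hqs

/-- The program `c` leads from `σ` to `σ'` within `T` steps, whatever the oracle, without queries. -/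
def Runs (c : Cmd) (σ σ' : Store) (T : ℕ) : Prop :=
  ∃ t ≤ T, ∀ O, Exec O c σ σ' t []

namespace Runs

variable {c d e : Cmd} {σ σ' σ'' : Store} {T T' : ℕ}

theorem mono (h : Runs c σ σ' T) (hT : T ≤ T') : Runs c σ σ' T' :=
  let ⟨t, ht, h⟩ := h
  ⟨t, ht.trans hT, h⟩

theorem of_exec {O : Str → Str} {t : ℕ} (h : Exec O c σ σ' t []) : Runs c σ σ' t :=
  ⟨t, le_rfl, fun _ => h.congr_oracle (by simp)⟩

theorem skip : Runs Cmd.skip σ σ 1 := ⟨1, le_rfl, fun _ => .skip σ⟩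

theorem push (b : Bool) (r : ℕ) : Runs (Cmd.push b r) σ (Function.update σ r (b :: σ r)) 1 :=
  ⟨1, le_rfl, fun _ => .push b r σ⟩

theorem pop (r : ℕ) : Runs (Cmd.pop r) σ (Function.update σ r (σ r).tail) 1 :=
  ⟨1, le_rfl, fun _ => .pop r σ⟩

theorem seq (h : Runs c σ σ' T) (h' : Runs d σ' σ'' T') :
    Runs (Cmd.seq c d) σ σ'' (T + T' + 1) := by
  obtain ⟨t, ht, h⟩ := h
  obtain ⟨t', ht', h'⟩ := h'
  exact ⟨t + t' + 1, by omega, fun O => .seq (h O) (h' O)⟩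

theorem branch_empty {r : ℕ} (hr : σ r = []) (h : Runs c σ σ' T) :
    Runs (Cmd.branch r c d e) σ σ' (T + 1) :=
  let ⟨t, ht, h⟩ := h
  ⟨t + 1, by omega, fun O => .branch_empty hr (h O)⟩

theorem branch_zero {r : ℕ} {w : Str} (hr : σ r = false :: w) (h : Runs d σ σ' T) :
    Runs (Cmd.branch r c d e) σ σ' (T + 1) :=
  let ⟨t, ht, h⟩ := h
  ⟨t + 1, by omega, fun O => .branch_zero hr (h O)⟩

theorem branch_one {r : ℕ} {w : Str} (hr : σ r = true :: w) (h : Runs e σ σ' T) :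
    Runs (Cmd.branch r c d e) σ σ' (T + 1) :=
  let ⟨t, ht, h⟩ := h
  ⟨t + 1, by omega, fun O => .branch_one hr (h O)⟩

theorem loop_done {r : ℕ} (hr : σ r = []) : Runs (Cmd.loop r c) σ σ 1 :=
  ⟨1, le_rfl, fun _ => .loop_done hr⟩

theorem loop_step {r : ℕ} (hr : σ r ≠ []) (h : Runs c σ σ' T)
    (h' : Runs (Cmd.loop r c) σ' σ'' T') : Runs (Cmd.loop r c) σ σ'' (T + T' + 1) := by
  obtain ⟨t, ht, h⟩ := h
  obtain ⟨t', ht', h'⟩ := h'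
  exact ⟨t + t' + 1, by omega, fun O => .loop_step hr (h O) (h' O)⟩

theorem length_le (h : Runs c σ σ' T) (r : ℕ) : (σ' r).length ≤ (σ r).length + T := by
  obtain ⟨t, ht, h⟩ := h
  have := (h fun _ => []).length_le rfl r
  omega

end Runs

/-! ### Stores with finitely many nonempty stacks -/

namespace Store

theorem update_input {l : List Str} {r : ℕ} (h : r < l.length) (v : Str) :
    Function.update (input l) r v = input (l.set r v) := by
  funext s
  by_cases hs : s = r
  · subst hs; simp [input, List.getD, h]
  · simp [input, List.getD, Function.update_of_ne hs, Ne.symm hs]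

/-- Absent stacks and empty stacks are the same store, so scratch stacks can be added to a list
whenever a program needs them. -/
theorem input_append_replicate (l : List Str) (k : ℕ) :
    input (l ++ List.replicate k []) = input l := by
  funext s
  simp only [input, List.getD, List.getElem?_append, List.getElem?_replicate]
  split_ifs with h h' <;> simp_all

theorem input_append_nil (l : List Str) : input (l ++ [[]]) = input l :=
  input_append_replicate l 1

end Store

namespace Cmd

/-! ### Basic programs -/

/-- Empty the stack `r`. -/
def clr (r : ℕ) : Cmd := loop r (pop r)

/-- Empty the stacks `1, …, k`. -/
def clrs : ℕ → Cmd
  | 0 => skip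
  | k + 1 => seq (clrs k) (clr (k + 1))

/-- Repeat, for each bit on the stack `r`: remove it and execute the body for that bit. -/
def each (r : ℕ) (c d : Cmd) : Cmd := loop r (branch r skip (seq (pop r) c) (seq (pop r) d))

/-- Move the stack `r`, in reversed order, to the stack `s`. -/
def rmv (r s : ℕ) : Cmd := each r (push false s) (push true s)

/-- Move the stack `r`, in reversed order, to the stacks `s` and `s'`. -/
def rmv₂ (r s s' : ℕ) : Cmd :=
  each r (seq (push false s) (push false s')) (seq (push true s) (push true s'))

/-- Move the stack `r`, in reversed order, to the stack `s`, with a marker `1` before each bit. -/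
def rmvMark (r s : ℕ) : Cmd :=
  each r (seq (push false s) (push true s)) (seq (push true s) (push true s))

/-- Move the stack `r` to `s` with the auxiliary stack `a`. -/
def mv (r s a : ℕ) : Cmd := seq (rmv r a) (rmv a s)

/-- Copy the stack `r` to `s` with the auxiliary stack `a`. -/
def cp (r s a : ℕ) : Cmd := seq (rmv r a) (rmv₂ a r s)

/-- Split the marked bits off the stack `r` and put them, reversed, on the stack `s`. -/
def unmark (r s a : ℕ) : Cmd :=
  seq (push true a) (loop a (branch r (pop a) (seq (pop r) (pop a))
    (seq (pop r) (branch r skip (seq (pop r) (push false s)) (seq (pop r) (push true s))))))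

end Cmd

namespace Runs

open Cmd

theorem clr (r : ℕ) (σ : Store) : Runs (clr r) σ (Function.update σ r []) (2 * (σ r).length + 1) := by
  generalize hn : σ r = l
  induction l generalizing σ with
  | nil => rw [← hn, Function.update_eq_self]; exact (loop_done hn).mono (by omega)
  | cons b l ih =>
    have := loop_step (by simp [hn]) (Runs.pop r) (ih (Function.update σ r (σ r).tail) (by simp [hn]))
    rw [Function.update_idem] at this
    exact this.mono (by simp; omega)

/-- `G l p` is the store in which `l` is still to be read and `p` is the part already read, in
reversed order. Beyond the body, each bit pays for the loop, the branch, the `seq` and the `pop`. -/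
theorem each {r : ℕ} {c d : Cmd} {T : ℕ} {G : Str → Str → Store} (hG : ∀ l p, G l p r = l)
    (hc : ∀ l p, Runs c (Function.update (G (false :: l) p) r l) (G l (false :: p)) T)
    (hd : ∀ l p, Runs d (Function.update (G (true :: l) p) r l) (G l (true :: p)) T) :
    ∀ l p, Runs (each r c d) (G l p) (G [] (l.reverse ++ p)) ((T + 4) * l.length + 1)
  | [], p => loop_done (hG [] p)
  | b :: l, p => by
    have ih := each hG hc hd l (b :: p)
    have hp : Runs (Cmd.pop r) (G (b :: l) p) (Function.update (G (b :: l) p) r l) 1 := by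
      simpa [hG] using Runs.pop (σ := G (b :: l) p) r
    have key : Runs (branch r Cmd.skip (Cmd.seq (Cmd.pop r) c) (Cmd.seq (Cmd.pop r) d)) (G (b :: l) p)
        (G l (b :: p)) (T + 3) := by
      cases b with
      | false => exact (branch_zero (hG _ p) (hp.seq (hc l p))).mono (by omega)
      | true => exact (branch_one (hG _ p) (hp.seq (hd l p))).mono (by omega)
    have := loop_step (by simp [hG]) key ih
    rw [List.reverse_cons, List.append_assoc, List.singleton_append]
    refine this.mono ?_
    simp only [List.length_cons]
    ring_nf
    omega

theorem rmv {r s : ℕ} (hrs : r ≠ s) (σ : Store) : Runs (rmv r s) σ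
    (Function.update (Function.update σ r []) s ((σ r).reverse ++ σ s)) (5 * (σ r).length + 1) := by
  have := each (r := r) (c := Cmd.push false s) (d := Cmd.push true s) (T := 1)
    (G := fun l p => Function.update (Function.update σ r l) s (p ++ σ s))
    (fun l p => by simp [hrs]) (fun l p => ?_) (fun l p => ?_) (σ r) []
  · simpa [Cmd.rmv] using this
  all_goals
    convert Runs.push _ s using 1
    funext x
    simp only [Function.update_apply]
    split_ifs <;> simp_all

theorem rmv₂ {r s s' : ℕ} (hrs : r ≠ s) (hrs' : r ≠ s') (hss' : s ≠ s') (σ : Store) :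
    Runs (rmv₂ r s s') σ (Function.update (Function.update (Function.update σ r []) s
      ((σ r).reverse ++ σ s)) s' ((σ r).reverse ++ σ s')) (7 * (σ r).length + 1) := by
  have := each (r := r) (c := Cmd.seq (Cmd.push false s) (Cmd.push false s'))
    (d := Cmd.seq (Cmd.push true s) (Cmd.push true s')) (T := 3)
    (G := fun l p => Function.update (Function.update (Function.update σ r l) s (p ++ σ s)) s'
      (p ++ σ s')) (fun l p => by simp [hrs, hrs']) (fun l p => ?_) (fun l p => ?_) (σ r) []
  · simpa [Cmd.rmv₂] using this
  all_goals
    convert (Runs.push _ s).seq (Runs.push _ s') using 1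
    funext x
    simp only [Function.update_apply]
    split_ifs <;> simp_all

end Runs

/-- A self-delimiting encoding of a bit string. -/
def dbl (x : Str) : Str := x.flatMap fun b => [true, b]

/-- Pairing of bit strings. -/
def pr (x y : Str) : Str := dbl x ++ false :: y

@[simp] theorem dbl_nil : dbl [] = [] := rfl

@[simp] theorem dbl_cons (b : Bool) (x : Str) : dbl (b :: x) = true :: b :: dbl x := rfl

@[simp] theorem length_dbl (x : Str) : (dbl x).length = 2 * x.length := by
  induction x with
  | nil => rfl
  | cons b x ih => simp [ih]; omega

theorem length_pr (x y : Str) : (pr x y).length = 2 * x.length + 1 + y.length := by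
  simp [pr]; omega

theorem pr_ne_nil (x y : Str) : pr x y ≠ [] := by simp [pr]

namespace Runs

open Cmd

theorem rmvMark {r s : ℕ} (hrs : r ≠ s) (σ : Store) : Runs (rmvMark r s) σ
    (Function.update (Function.update σ r []) s (dbl (σ r).reverse ++ σ s))
    (7 * (σ r).length + 1) := by
  have := each (r := r) (c := Cmd.seq (Cmd.push false s) (Cmd.push true s))
    (d := Cmd.seq (Cmd.push true s) (Cmd.push true s)) (T := 3)
    (G := fun l p => Function.update (Function.update σ r l) s (dbl p ++ σ s))
    (fun l p => by simp [hrs]) (fun l p => ?_) (fun l p => ?_) (σ r) []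
  · simpa [Cmd.rmvMark] using this
  all_goals
    convert (Runs.push _ s).seq (Runs.push _ s) using 1
    funext x
    simp only [Function.update_apply]
    split_ifs <;> simp_all

theorem mv {r s a : ℕ} (hrs : r ≠ s) (hra : r ≠ a) (hsa : s ≠ a) (σ : Store) (ha : σ a = []) :
    Runs (mv r s a) σ (Function.update (Function.update σ r []) s (σ r ++ σ s))
      (10 * (σ r).length + 3) := by
  refine Runs.mono (Runs.seq (rmv hra σ) ?_) (T := 5 * (σ r).length + 1 + (5 * (σ r).length + 1) + 1)
    (by omega)
  convert rmv hsa.symm _ using 1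
  · funext x
    simp only [Function.update_apply]
    split_ifs <;> simp_all
  · simp [ha]

theorem cp {r s a : ℕ} (hrs : r ≠ s) (hra : r ≠ a) (hsa : s ≠ a) (σ : Store) (ha : σ a = []) :
    Runs (cp r s a) σ (Function.update σ s (σ r ++ σ s)) (12 * (σ r).length + 3) := by
  refine Runs.mono (Runs.seq (rmv hra σ) ?_) (T := 5 * (σ r).length + 1 + (7 * (σ r).length + 1) + 1)
    (by omega)
  convert rmv₂ hra.symm hsa.symm hrs _ using 1
  · funext x
    simp only [Function.update_apply]
    split_ifs <;> simp_all
  · simp [ha]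

/-- The end of the marked part is a separator bit, not an empty stack, and a loop can test only
emptiness. The stack `a` therefore carries one flag bit, which is popped when the separator is met.
-/
theorem unmark {r s a : ℕ} (hrs : r ≠ s) (hra : r ≠ a) (hsa : s ≠ a) (x y : Str) (σ : Store)
    (hr : σ r = pr x y) (ha : σ a = []) :
    Runs (unmark r s a) σ (Function.update (Function.update σ r y) s (x.reverse ++ σ s))
      (8 * x.length + 8) := by
  have main : ∀ (x : Str) (σ : Store), σ r = pr x y → σ a = [true] →
      Runs (loop a (branch r (Cmd.pop a) (Cmd.seq (Cmd.pop r) (Cmd.pop a))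
        (Cmd.seq (Cmd.pop r) (branch r Cmd.skip (Cmd.seq (Cmd.pop r) (Cmd.push false s))
          (Cmd.seq (Cmd.pop r) (Cmd.push true s)))))) σ
        (Function.update (Function.update (Function.update σ r y) s (x.reverse ++ σ s)) a [])
        (8 * x.length + 6) := by
    intro x
    induction x with
    | nil =>
      intro σ hr ha
      have h1 := branch_zero (c := Cmd.pop a) (e := (Cmd.seq (Cmd.pop r) (branch r Cmd.skip
        (Cmd.seq (Cmd.pop r) (Cmd.push false s)) (Cmd.seq (Cmd.pop r) (Cmd.push true s)))))
        (w := y) hr ((Runs.pop r).seq (Runs.pop a))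
      refine (loop_step (by simp [ha]) h1 ?_).mono (T := 1 + 1 + 1 + 1 + 1 + 1) (by simp)
      convert Runs.loop_done ?_ using 1
      · funext x
        simp only [Function.update_apply]
        split_ifs <;> simp_all [pr]
      · simp [Function.update_of_ne hra.symm, ha]
    | cons b x ih =>
      intro σ hr ha
      have h1 : Runs (branch r Cmd.skip (Cmd.seq (Cmd.pop r) (Cmd.push false s))
          (Cmd.seq (Cmd.pop r) (Cmd.push true s))) (Function.update σ r (σ r).tail)
          (Function.update (Function.update σ r (pr x y)) s (b :: σ s)) 4 := by
        cases b with
        | false =>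
          convert branch_zero (w := pr x y) ?_ ((Runs.pop r).seq (Runs.push false s)) using 1
          · funext x
            simp only [Function.update_apply]
            split_ifs <;> simp_all [pr]
          · simp [hr, pr]
        | true =>
          convert branch_one (w := pr x y) ?_ ((Runs.pop r).seq (Runs.push true s)) using 1
          · funext x
            simp only [Function.update_apply]
            split_ifs <;> simp_all [pr]
          · simp [hr, pr]
      have h2 := branch_one (c := Cmd.pop a) (d := Cmd.seq (Cmd.pop r) (Cmd.pop a))
        (r := r) (w := b :: pr x y) (by simp [hr, pr]) ((Runs.pop r).seq h1)
      have h3 := loop_step (by simp [ha]) h2 (ih _ (by simp [hrs])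
        (by simp [ha, hra.symm, hsa.symm]))
      convert h3.mono (T' := 8 * (b :: x).length + 6) (by simp; omega) using 1
      funext x
      simp only [Function.update_apply]
      split_ifs <;> simp_all
  have := (Runs.push true a).seq (main x (Function.update σ a (true :: σ a)) (by simp [hra, hr])
    (by simp [ha]))
  convert this.mono (T' := 8 * x.length + 8) (by omega) using 1
  · rfl
  · funext x
    simp only [Function.update_apply]
    split_ifs <;> simp_all

end Runs

/-! ### Polynomial-time functions on encoded data -/

theorem Polynomial.eval_le_eval_nat (p : Polynomial ℕ) {m n : ℕ} (h : m ≤ n) :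
    p.eval m ≤ p.eval n := by
  rw [Polynomial.eval_eq_sum_range, Polynomial.eval_eq_sum_range]
  exact Finset.sum_le_sum fun i _ => Nat.mul_le_mul_left _ (Nat.pow_le_pow_left h i)

namespace Cmd

/-- Run `c` with its input and output on the stack `i`, using the stacks from `N` on as scratch. -/
def call (c : Cmd) (i N : ℕ) : Cmd := c.ren fun r => r.casesOn i fun k => N + k

end Cmd

namespace Runs

open Cmd

theorem congr {c : Cmd} {σ σ' σ'' : Store} {T T' : ℕ} (h : Runs c σ σ' T) (hσ : σ'' = σ')
    (hT : T ≤ T') : Runs c σ σ'' T' :=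
  hσ ▸ h.mono hT

/-- Stack `0` of `c` becomes stack `i`, and all its other stacks lie beyond the list. They start
empty and, as `c` leaves only its output, end empty, so the result is again described by a list. -/
theorem call {c : Cmd} {x y : Str} {T : ℕ} (h : Runs c (Store.input [x]) (Store.input [y]) T)
    {l : List Str} {i : ℕ} (hi : l[i]? = some x) :
    Runs (c.call i l.length) (Store.input l) (Store.input (l.set i y)) T := by
  obtain ⟨hi', hx⟩ := List.getElem?_eq_some_iff.1 hi
  obtain ⟨t, ht, h⟩ := h
  refine ⟨t, ht, fun O => ?_⟩
  have hρ : Function.Injective fun r : ℕ => (r.casesOn i fun k => l.length + k : ℕ) := by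
    rintro (_ | r) (_ | s) h <;> simp at h ⊢ <;> omega
  obtain ⟨τ', h1, h2, h3⟩ := (h O).rename hρ (Store.input l) (by
    rintro (_ | r) <;> simp [Store.input, hi])
  suffices Store.input (l.set i y) = τ' from this ▸ h1
  funext s
  by_cases hs : s ∈ Set.range fun r : ℕ => (r.casesOn i fun k => l.length + k : ℕ)
  · obtain ⟨r, rfl⟩ := hs
    rw [h2]
    cases r <;> simp [Store.input, hi']
  · rw [h3 s hs]
    have : s ≠ i := fun h => hs ⟨0, h.symm⟩
    simp [Store.input, List.getD, this.symm]

theorem clrs {L : ℕ} : ∀ (k : ℕ) (σ : Store), (∀ r, (σ r).length ≤ L) →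
    Runs (clrs k) σ (fun r => if 1 ≤ r ∧ r ≤ k then [] else σ r) (k * (2 * L + 2) + 1)
  | 0, σ, _ => by
    refine Runs.skip.congr ?_ (by omega)
    funext r
    rw [if_neg (by omega)]
  | k + 1, σ, h => by
    refine ((clrs k σ h).seq (Runs.clr (k + 1) _)).congr ?_ ?_
    · funext r
      by_cases hr : r = k + 1
      · simp [hr]
      · rw [Function.update_of_ne hr]
        congr 1
        apply propext
        omega
    · have := h (k + 1)
      rw [if_neg (by omega), Nat.succ_mul k]
      generalize k * (2 * L + 2) = A
      omega

theorem push_input {l : List Str} (b : Bool) {r : ℕ} (h : r < l.length) :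
    Runs (Cmd.push b r) (Store.input l) (Store.input (l.set r (b :: l.getD r []))) 1 := by
  rw [← Store.update_input h]; exact Runs.push b r

theorem pop_input {l : List Str} {r : ℕ} (h : r < l.length) :
    Runs (Cmd.pop r) (Store.input l) (Store.input (l.set r (l.getD r []).tail)) 1 := by
  rw [← Store.update_input h]; exact Runs.pop r

theorem clr_input {l : List Str} {r : ℕ} (h : r < l.length) :
    Runs (Cmd.clr r) (Store.input l) (Store.input (l.set r [])) (2 * (l.getD r []).length + 1) := by
  rw [← Store.update_input h]; exact Runs.clr r _

theorem cp_input {l : List Str} {r s a : ℕ} (hs : s < l.length)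
    (hrs : r ≠ s) (hra : r ≠ a) (hsa : s ≠ a) (ha : l.getD a [] = []) :
    Runs (Cmd.cp r s a) (Store.input l) (Store.input (l.set s (l.getD r [] ++ l.getD s [])))
      (12 * (l.getD r []).length + 3) := by
  rw [← Store.update_input hs]; exact Runs.cp hrs hra hsa _ ha

theorem mv_input {l : List Str} {r s a : ℕ} (hr : r < l.length) (hs : s < l.length)
    (hrs : r ≠ s) (hra : r ≠ a) (hsa : s ≠ a) (ha : l.getD a [] = []) :
    Runs (Cmd.mv r s a) (Store.input l)
      (Store.input ((l.set r []).set s (l.getD r [] ++ l.getD s [])))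
      (10 * (l.getD r []).length + 3) := by
  rw [← Store.update_input (by simpa using hs), ← Store.update_input hr]
  exact Runs.mv hrs hra hsa _ ha

theorem rmv_input {l : List Str} {r s : ℕ} (hr : r < l.length) (hs : s < l.length)
    (hrs : r ≠ s) :
    Runs (Cmd.rmv r s) (Store.input l)
      (Store.input ((l.set r []).set s ((l.getD r []).reverse ++ l.getD s [])))
      (5 * (l.getD r []).length + 1) := by
  rw [← Store.update_input (by simpa using hs), ← Store.update_input hr]
  exact Runs.rmv hrs _

theorem unmark_input {l : List Str} {r s a : ℕ} (hr : r < l.length) (hs : s < l.length)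
    (hrs : r ≠ s) (hra : r ≠ a) (hsa : s ≠ a) (x y : Str) (hx : l.getD r [] = pr x y)
    (ha : l.getD a [] = []) :
    Runs (Cmd.unmark r s a) (Store.input l)
      (Store.input ((l.set r y).set s (x.reverse ++ l.getD s []))) (8 * x.length + 8) := by
  rw [← Store.update_input (by simpa using hs), ← Store.update_input hr]
  exact Runs.unmark hrs hra hsa x y _ hx ha

end Runs

namespace Cmd

/-- Put the pair of the contents of the stacks `r` and `s` on the stack `s`. -/
def mkPair (r s a : ℕ) : Cmd := seq (rmv r a) (seq (push false s) (rmvMark a s))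

end Cmd

theorem Runs.mkPair_input {l : List Str} {r s a : ℕ} (hr : r < l.length) (hs : s < l.length)
    (hrs : r ≠ s) (hra : r ≠ a) (hsa : s ≠ a) (ha : l.getD a [] = []) :
    Runs (Cmd.mkPair r s a) (Store.input l)
      (Store.input ((l.set r []).set s (pr (l.getD r []) (l.getD s []))))
      (12 * (l.getD r []).length + 5) := by
  rw [← Store.update_input (by simpa using hs), ← Store.update_input hr]
  change Runs _ _ (Function.update (Function.update _ r []) s
    (pr (Store.input l r) (Store.input l s))) (12 * (Store.input l r).length + 5)
  replace ha : Store.input l a = [] := ha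
  generalize Store.input l = σ at ha ⊢
  refine ((Runs.rmv hra σ).seq ((Runs.push false s).seq (Runs.rmvMark hsa.symm _))).congr ?_ ?_
  · funext x
    simp only [Function.update_apply]
    split_ifs <;> simp_all [pr]
  · simp [ha, hsa.symm]
    omega

/-- Data with an encoding by bit strings. -/
class Enc (α : Type) where
  enc : α → Str

open Enc

instance : Enc Str := ⟨fun x => x⟩

/-- Unary, so that numbers can serve as loop counters and a polynomial bound on the length is a
bound on the value. -/
instance : Enc ℕ := ⟨fun n => List.replicate n true⟩

instance : Enc Unit := ⟨fun _ => []⟩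

instance : Enc Empty := ⟨fun _ => []⟩

instance {α β : Type} [Enc α] [Enc β] : Enc (α × β) := ⟨fun a => pr (enc a.1) (enc a.2)⟩

instance {α β : Type} [Enc α] [Enc β] : Enc (α ⊕ β) :=
  ⟨fun a => a.elim (fun a => false :: enc a) fun b => true :: enc b⟩

instance {α : Type} [Enc α] : Enc (List α) := ⟨fun l => l.foldr (fun a s => pr (enc a) s) []⟩

section Encodings

variable {α β : Type} [Enc α] [Enc β]

theorem enc_str (x : Str) : enc x = x := rfl

theorem enc_nat (n : ℕ) : enc n = List.replicate n true := rfl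

theorem enc_pair (a : α) (b : β) : enc (a, b) = pr (enc a) (enc b) := rfl

theorem enc_nil : enc ([] : List α) = [] := rfl

theorem enc_cons (a : α) (l : List α) : enc (a :: l) = pr (enc a) (enc l) := rfl

end Encodings

/-- The function `f` is computable in polynomial time with respect to the encodings. -/
@[fun_prop]
def PT {α β : Type} [Enc α] [Enc β] (f : α → β) : Prop :=
  ∃ (c : Cmd) (p : Polynomial ℕ), ∀ a, Runs c (Store.input [enc a]) (Store.input [enc (f a)])
    (p.eval (enc a).length)

section Clean

theorem Computes.runs {c : Cmd} {x : List Str} {y : Str} {t : ℕ} (h : Computes c x y t) :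
    ∃ σ : Store, Runs c (Store.input x) σ t ∧ σ 0 = y := by
  obtain ⟨σ, h, rfl⟩ := h
  exact ⟨σ, .of_exec h, rfl⟩

/-- `PT` demands that only the output remains, so that programs can be composed. Finitely many
stacks are mentioned, and each is no longer than the input plus the running time, so clearing them
is affordable. -/
theorem Runs.clean {c : Cmd} {x : Str} {σ : Store} {T : ℕ} (h : Runs c (Store.input [x]) σ T) :
    Runs (c.seq (Cmd.clrs c.bound)) (Store.input [x]) (Store.input [σ 0])
      (T + (c.bound * (2 * (x.length + T) + 2) + 1) + 1) := by
  have hl : ∀ r, (σ r).length ≤ x.length + T := by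
    intro r
    have := h.length_le r
    have : (Store.input [x] r).length ≤ x.length := by
      cases r <;> simp [Store.input]
    omega
  have hb : ∀ r, 1 ≤ r → c.bound ≤ r → σ r = [] := by
    intro r hr hb
    obtain ⟨t, -, h⟩ := h
    rw [(h fun _ => []).eq_of_bound_le r hb]
    cases r with
    | zero => omega
    | succ r => simp [Store.input]
  refine (h.seq (Runs.clrs c.bound σ hl)).congr ?_ le_rfl
  funext r
  cases r with
  | zero => simp [Store.input]
  | succ r =>
    by_cases hr : r + 1 ≤ c.bound
    · simp [Store.input, hr]
    · simp [Store.input, hr, hb (r + 1) (by omega) (by omega)]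

open Polynomial in
theorem PT.of_computes {α β : Type} [Enc α] [Enc β] {f : α → β} {c : Cmd} {p : Polynomial ℕ}
    (h : ∀ a, ∃ t, Computes c [enc a] (enc (f a)) t ∧ t ≤ p.eval (enc a).length) : PT f := by
  refine ⟨c.seq (Cmd.clrs c.bound), p + (C c.bound * (2 * (X + p) + 2) + 1) + 1, fun a => ?_⟩
  obtain ⟨t, h, ht⟩ := h a
  obtain ⟨σ, h, h0⟩ := h.runs
  rw [← h0]
  simpa using (h.mono ht).clean

theorem PolyTimeFun.pt {f : Str → Str} (h : PolyTimeFun f) : PT f := by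
  obtain ⟨c, p, h⟩ := h
  exact .of_computes h

theorem PT.polyTimeFun {f : Str → Str} (h : PT f) : PolyTimeFun f := by
  obtain ⟨c, p, h⟩ := h
  refine ⟨c, p, fun x => ?_⟩
  obtain ⟨t, ht, h⟩ := h x
  exact ⟨t, ⟨_, h _, rfl⟩, ht⟩

end Clean

/-! ### Closure properties of polynomial time -/

namespace Cmd

/-- Push the bits of `w`, the last one first. -/
def pushes (r : ℕ) : Str → Cmd
  | [] => skip
  | b :: w => seq (pushes r w) (push b r)

end Cmd

theorem Runs.pushes_input {l : List Str} {r : ℕ} (h : r < l.length) : ∀ w : Str,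
    Runs (Cmd.pushes r w) (Store.input l) (Store.input (l.set r (w ++ l.getD r []))) (2 * w.length + 1)
  | [] => Runs.skip.congr (by rw [← Store.update_input h]; exact Function.update_eq_self _ _) (by simp)
  | b :: w => by
    refine ((Runs.pushes_input h w).seq (Runs.push_input b (by simpa using h))).congr ?_ ?_
    · simp [List.getD, h]
    · simp; omega

namespace PT

open Polynomial

variable {α β γ δ ε : Type} [Enc α] [Enc β] [Enc γ] [Enc δ] [Enc ε]

theorem length_enc_le {f : α → β} (h : PT f) :
    ∃ p : Polynomial ℕ, ∀ a, (enc (f a)).length ≤ p.eval (enc a).length := by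
  obtain ⟨c, p, h⟩ := h
  exact ⟨X + p, fun a => by simpa [Store.input] using (h a).length_le 0⟩

/-- A function that does not change the encoding. -/
theorem of_enc_eq {f : α → β} (h : ∀ a, enc (f a) = enc a) : PT f :=
  ⟨.skip, 1, fun a => by rw [h]; exact Runs.skip.mono (by simp)⟩

@[fun_prop]
theorem id : PT fun a : α => a := of_enc_eq fun _ => rfl

theorem congr {f g : α → β} (h : PT f) (hfg : ∀ a, g a = f a) : PT g := by
  rwa [show g = f from funext hfg]

@[fun_prop]
theorem const (b : β) : PT fun _ : α => b := by
  refine ⟨(Cmd.clr 0).seq (Cmd.pushes 0 (enc b)), 2 * X + C (2 * (enc b).length + 3), fun a => ?_⟩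
  refine ((Runs.clr_input (by simp)).seq (Runs.pushes_input (by simp) (enc b))).congr ?_ ?_
  · simp
  · simp; omega

@[fun_prop]
theorem comp {g : β → γ} {f : α → β} (hg : PT g) (hf : PT f) : PT fun a => g (f a) := by
  obtain ⟨p', hp'⟩ := hf.length_enc_le
  obtain ⟨c, p, hf⟩ := hf
  obtain ⟨d, q, hg⟩ := hg
  refine ⟨c.seq d, p + q.comp p' + 1, fun a => ((hf a).seq (hg (f a))).mono ?_⟩
  have := q.eval_le_eval_nat (hp' a)
  simp [eval_comp]
  omega

@[fun_prop]
theorem prodMk {f : α → β} {g : α → γ} (hf : PT f) (hg : PT g) : PT fun a => (f a, g a) := by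
  obtain ⟨p', hp'⟩ := hf.length_enc_le
  obtain ⟨c, p, hf⟩ := hf
  obtain ⟨d, q, hg⟩ := hg
  obtain ⟨q', hq'⟩ : ∃ q' : Polynomial ℕ, ∀ a, (enc (g a)).length ≤ q'.eval (enc a).length :=
    length_enc_le ⟨d, q, hg⟩
  refine ⟨.seq (.cp 0 1 2) (.seq (c.call 0 3) (.seq (d.call 1 3) (.seq (.mkPair 0 1 2)
    (.mv 1 0 2)))), 12 * X + p + q + 32 * p' + 10 * q' + 100, fun a => ?_⟩
  -- Two empty scratch stacks are added to the initial and to the final store.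
  rw [← Store.input_append_nil, ← Store.input_append_nil, ← Store.input_append_nil [_],
    ← Store.input_append_nil ([_] ++ _)]
  have h1 : Runs (.cp 0 1 2) (Store.input [enc a, [], []]) _ _ :=
    Runs.cp_input (by simp) (by simp) (by simp) (by simp) (by simp)
  have h2 := (hf a).call (l := [enc a, enc a, []]) (i := 0) (by simp)
  have h3 := (hg a).call (l := [enc (f a), enc a, []]) (i := 1) (by simp)
  have h4 : Runs (.mkPair 0 1 2) (Store.input [enc (f a), enc (g a), []]) _ _ :=
    Runs.mkPair_input (by simp) (by simp) (by simp) (by simp) (by simp) (by simp)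
  have h5 : Runs (.mv 1 0 2) (Store.input [[], pr (enc (f a)) (enc (g a)), []]) _ _ :=
    Runs.mv_input (by simp) (by simp) (by simp) (by simp) (by simp) (by simp)
  simp only [List.getD_cons_zero, List.getD_cons_succ, List.set_cons_zero, List.set_cons_succ,
    List.append_nil, List.length_cons, List.length_nil, length_pr] at h1 h2 h3 h4 h5
  refine (h1.seq (h2.seq (h3.seq (h4.seq h5)))).congr rfl ?_
  have := hp' a
  have := hq' a
  simp
  omega

@[fun_prop]
theorem fst : PT fun a : α × β => a.1 := by
  refine ⟨.seq (.unmark 0 1 2) (.seq (.clr 0) (.rmv 1 0)), 20 * X + 20, fun a => ?_⟩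
  rw [← Store.input_append_nil, ← Store.input_append_nil, ← Store.input_append_nil [_],
    ← Store.input_append_nil ([_] ++ _)]
  have h1 : Runs (.unmark 0 1 2) (Store.input [enc a, [], []]) _ _ :=
    Runs.unmark_input (by simp) (by simp) (by simp) (by simp) (by simp) (enc a.1) (enc a.2) rfl
      (by simp)
  have h2 : Runs (.clr 0) (Store.input [enc a.2, (enc a.1).reverse, []]) _ _ :=
    Runs.clr_input (by simp)
  have h3 : Runs (.rmv 1 0) (Store.input [[], (enc a.1).reverse, []]) _ _ :=
    Runs.rmv_input (by simp) (by simp) (by simp)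
  simp only [List.getD_cons_zero, List.getD_cons_succ, List.set_cons_zero, List.set_cons_succ,
    List.append_nil, List.reverse_reverse, List.length_reverse] at h1 h2 h3
  refine (h1.seq (h2.seq h3)).congr rfl ?_
  have : (enc a).length = _ := length_pr (enc a.1) (enc a.2)
  simp
  omega

@[fun_prop]
theorem snd : PT fun a : α × β => a.2 := by
  refine ⟨.seq (.unmark 0 1 2) (.clr 1), 20 * X + 20, fun a => ?_⟩
  rw [← Store.input_append_nil, ← Store.input_append_nil, ← Store.input_append_nil [_],
    ← Store.input_append_nil ([_] ++ _)]
  have h1 : Runs (.unmark 0 1 2) (Store.input [enc a, [], []]) _ _ :=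
    Runs.unmark_input (by simp) (by simp) (by simp) (by simp) (by simp) (enc a.1) (enc a.2) rfl
      (by simp)
  have h2 : Runs (.clr 1) (Store.input [enc a.2, (enc a.1).reverse, []]) _ _ :=
    Runs.clr_input (by simp)
  simp only [List.getD_cons_zero, List.getD_cons_succ, List.set_cons_zero, List.set_cons_succ,
    List.append_nil, List.length_reverse] at h1 h2
  refine (h1.seq h2).congr rfl ?_
  have : (enc a).length = _ := length_pr (enc a.1) (enc a.2)
  simp
  omega

@[fun_prop]
theorem fst_comp {f : α → β × γ} (h : PT f) : PT fun a => (f a).1 := fst.comp h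

@[fun_prop]
theorem snd_comp {f : α → β × γ} (h : PT f) : PT fun a => (f a).2 := snd.comp h

/-- Case distinction on a string: the general form. -/
theorem cases {α' : Type} [Enc α'] {s : α → Str} {r : α → δ} {f : α' → δ} {g : β → δ} {h : γ → δ}
    (hs : PT s) (hf : PT f) (hg : PT g) (hh : PT h)
    (hr : ∀ a, (s a = [] ∧ ∃ a', enc a' = enc a ∧ r a = f a') ∨
      (∃ w b, s a = false :: w ∧ enc b = pr (enc a) w ∧ r a = g b) ∨
      ∃ w c, s a = true :: w ∧ enc c = pr (enc a) w ∧ r a = h c) : PT r := by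
  obtain ⟨p', hp'⟩ := hs.length_enc_le
  obtain ⟨cs, ps, hs⟩ := hs
  obtain ⟨cf, pf, hf⟩ := hf
  obtain ⟨cg, pg, hg⟩ := hg
  obtain ⟨ch, ph, hh⟩ := hh
  refine ⟨.seq (.cp 0 1 2) (.seq (cs.call 1 3) (.branch 1 (cf.call 0 3)
    (.seq (.pop 1) (.seq (.mkPair 0 1 2) (.seq (.mv 1 0 2) (cg.call 0 3))))
    (.seq (.pop 1) (.seq (.mkPair 0 1 2) (.seq (.mv 1 0 2) (ch.call 0 3)))))),
    12 * X + ps + pf + pg.comp (2 * X + 1 + p') + ph.comp (2 * X + 1 + p') + 40 * X + 10 * p' + 200,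
    fun a => ?_⟩
  have h1 : Runs (.cp 0 1 2) (Store.input [enc a, [], []]) _ _ :=
    Runs.cp_input (by simp) (by simp) (by simp) (by simp) (by simp)
  have h2 := (hs a).call (l := [enc a, enc a, []]) (i := 1) (by simp)
  have h4 (w : Str) : Runs (.mkPair 0 1 2) (Store.input [enc a, w, []]) _ _ :=
    Runs.mkPair_input (by simp) (by simp) (by simp) (by simp) (by simp) (by simp)
  have h5 (w : Str) : Runs (.mv 1 0 2) (Store.input [[], pr (enc a) w, []]) _ _ :=
    Runs.mv_input (by simp) (by simp) (by simp) (by simp) (by simp) (by simp)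
  have h3 (b : Bool) (w : Str) : Runs (.pop 1) (Store.input [enc a, b :: w, []]) _ _ :=
    Runs.pop_input (by simp)
  have hlen := hp' a
  rw [← Store.input_append_nil, ← Store.input_append_nil, ← Store.input_append_nil [_],
    ← Store.input_append_nil ([_] ++ _)]
  simp only [List.getD_cons_zero, List.getD_cons_succ, List.set_cons_zero, List.set_cons_succ,
    List.append_nil, List.length_cons, List.length_nil, List.tail_cons, length_pr, enc_str]
    at h1 h2 h3 h4 h5 hlen
  rcases hr a with ⟨hw, a', ha, hr⟩ | ⟨w, b, hw, hb, hr⟩ | ⟨w, b, hw, hb, hr⟩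
  · have h6 := (hf a').call (l := [enc a, [], []]) (i := 0) (by simp [ha])
    rw [hw] at h2
    rw [ha] at h6
    refine (h1.seq (h2.seq (.branch_empty rfl h6))).congr (by simp [hr]) ?_
    simp
    omega
  · have h6 := (hg b).call (l := [pr (enc a) w, [], []]) (i := 0) (by simp [hb])
    rw [hw] at h2 hlen
    refine (h1.seq (h2.seq (.branch_zero rfl ((h3 _ w).seq ((h4 w).seq ((h5 w).seq h6)))))).congr
      (by simp [hr]) ?_
    have := pg.eval_le_eval_nat (show (enc b).length ≤
      2 * (enc a).length + 1 + p'.eval (enc a).length by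
        rw [hb, length_pr]; simp at hlen; omega)
    simp [eval_comp] at hlen ⊢
    omega
  · have h6 := (hh b).call (l := [pr (enc a) w, [], []]) (i := 0) (by simp [hb])
    rw [hw] at h2 hlen
    refine (h1.seq (h2.seq (.branch_one rfl ((h3 _ w).seq ((h4 w).seq ((h5 w).seq h6)))))).congr
      (by simp [hr]) ?_
    have := ph.eval_le_eval_nat (show (enc b).length ≤
      2 * (enc a).length + 1 + p'.eval (enc a).length by
        rw [hb, length_pr]; simp at hlen; omega)
    simp [eval_comp] at hlen ⊢
    omega

/-- Bounded iteration: the step is repeated as often as the encoding of `n a` is long. -/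
theorem iterate {n : α → β} {init : α → γ} {step : α × γ → γ} (hn : PT n) (hi : PT init)
    (hs : PT step) (hb : ∃ p : Polynomial ℕ, ∀ a, ∀ i ≤ (enc (n a)).length,
      (enc ((fun x => step (a, x))^[i] (init a))).length ≤ p.eval (enc a).length) :
    PT fun a => (fun x => step (a, x))^[(enc (n a)).length] (init a) := by
  obtain ⟨B, hB⟩ := hb
  obtain ⟨pl, hpl⟩ := hn.length_enc_le
  obtain ⟨cn, pn, hn⟩ := hn
  obtain ⟨ci, pi, hi⟩ := hi
  obtain ⟨cs, ps, hs⟩ := hs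
  -- `K` bounds one round: copying the input, pairing it with the state, and running the step on a
  -- pair of length at most `2 * |a| + 1 + B`. The stacks hold the input, the counter, the state,
  -- and two scratch entries.
  let K : Polynomial ℕ := 24 * X + ps.comp (2 * X + 1 + B) + 100
  refine ⟨.seq (.cp 0 1 4) (.seq (cn.call 1 5) (.seq (.cp 0 2 4) (.seq (ci.call 2 5)
    (.seq (.loop 1 (.seq (.pop 1) (.seq (.cp 0 3 4) (.seq (.mkPair 3 2 4) (cs.call 2 5)))))
      (.seq (.clr 0) (.mv 2 0 3)))))), 24 * X + pn + pi + (K * pl + 1) + 2 * X + 10 * B + 100,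
    fun a => ?_⟩
  set F := fun x => step (a, x) with hF
  have loop : ∀ (w : Str) (i : ℕ), i + w.length = (enc (n a)).length →
      Runs (.loop 1 (.seq (.pop 1) (.seq (.cp 0 3 4) (.seq (.mkPair 3 2 4) (cs.call 2 5)))))
        (Store.input [enc a, w, enc (F^[i] (init a)), [], []])
        (Store.input [enc a, [], enc (F^[i + w.length] (init a)), [], []])
        (K.eval (enc a).length * w.length + 1) := by
    intro w
    induction w with
    | nil => exact fun i _ => Runs.loop_done rfl
    | cons b w ih =>
      intro i hi
      simp only [List.length_cons] at hi
      have hBi : (enc (F^[i] (init a))).length ≤ _ := hB a i (by omega)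
      have h0 : Runs (.pop 1) (Store.input [enc a, b :: w, enc (F^[i] (init a)), [], []]) _ _ :=
        Runs.pop_input (by simp)
      have h1 : Runs (.cp 0 3 4) (Store.input [enc a, w, enc (F^[i] (init a)), [], []]) _ _ :=
        Runs.cp_input (by simp) (by simp) (by simp) (by simp) (by simp)
      have h2 : Runs (.mkPair 3 2 4)
          (Store.input [enc a, w, enc (F^[i] (init a)), enc a, []]) _ _ :=
        Runs.mkPair_input (by simp) (by simp) (by simp) (by simp) (by simp) (by simp)
      have h3 := (hs (a, F^[i] (init a))).call
        (l := [enc a, w, enc (a, F^[i] (init a)), [], []]) (i := 2) (by simp)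
      have h4 := ih (i + 1) (by omega)
      simp only [List.getD_cons_zero, List.getD_cons_succ, List.set_cons_zero, List.set_cons_succ,
        List.append_nil, List.length_cons, List.length_nil, List.tail_cons] at h0 h1 h2 h3
      rw [Function.iterate_succ_apply'] at h4
      refine (Runs.loop_step (by simp [Store.input])
        (h0.seq (h1.seq (h2.seq h3))) h4).congr ?_ ?_
      · rw [List.length_cons, Nat.add_right_comm, Nat.add_assoc]
      · have := ps.eval_le_eval_nat (show (enc (a, F^[i] (init a))).length ≤
            2 * (enc a).length + 1 + B.eval (enc a).length by
          rw [enc_pair, length_pr]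
          omega)
        rw [List.length_cons, Nat.mul_succ]
        generalize eval _ K * w.length = m
        simp [K, eval_comp]
        omega
  have h1 : Runs (.cp 0 1 4) (Store.input [enc a, [], [], [], []]) _ _ :=
    Runs.cp_input (by simp) (by simp) (by simp) (by simp) (by simp)
  have h2 := (hn a).call (l := [enc a, enc a, [], [], []]) (i := 1) (by simp)
  have h3 : Runs (.cp 0 2 4) (Store.input [enc a, enc (n a), [], [], []]) _ _ :=
    Runs.cp_input (by simp) (by simp) (by simp) (by simp) (by simp)
  have h4 := (hi a).call (l := [enc a, enc (n a), enc a, [], []]) (i := 2) (by simp)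
  have h5 := loop (enc (n a)) 0 (by simp)
  rw [Nat.zero_add] at h5
  have hBn : (enc (F^[(enc (n a)).length] (init a))).length ≤ _ := hB a _ le_rfl
  change Runs _ _ (Store.input [enc (F^[(enc (n a)).length] (init a))]) _
  generalize F^[(enc (n a)).length] (init a) = z at h5 hBn ⊢
  have h6 : Runs (.clr 0) (Store.input [enc a, [], enc z, [], []]) _ _ := Runs.clr_input (by simp)
  have h7 : Runs (.mv 2 0 3) (Store.input [[], [], enc z, [], []]) _ _ :=
    Runs.mv_input (by simp) (by simp) (by simp) (by simp) (by simp) (by simp)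
  rw [← Store.input_append_replicate [_] 4, ← Store.input_append_replicate [enc z] 4]
  simp only [List.getD_cons_zero, List.getD_cons_succ, List.set_cons_zero, List.set_cons_succ,
    List.append_nil, List.length_cons, List.length_nil] at h1 h2 h3 h4 h6 h7
  refine (h1.seq (h2.seq (h3.seq (h4.seq (h5.seq (h6.seq h7)))))).congr rfl ?_
  have := Nat.mul_le_mul_left (K.eval (enc a).length) (hpl a)
  simp only [eval_add, eval_mul, eval_X, eval_one, eval_ofNat]
  omega

end PT

/-! ### Case distinctions, iteration with controlled growth, and arithmetic -/

namespace PT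

open Polynomial

variable {α β γ δ ε : Type} [Enc α] [Enc β] [Enc γ] [Enc δ] [Enc ε]

/-- Case distinction on a string. -/
theorem strCases {s : α → Str} {f : α → β} {g h : α × Str → β} (hs : PT s) (hf : PT f) (hg : PT g)
    (hh : PT h) : PT fun a => match s a with
      | [] => f a
      | false :: w => g (a, w)
      | true :: w => h (a, w) := by
  refine cases hs hf hg hh fun a => ?_
  rcases hw : s a with _ | ⟨_ | _, w⟩
  · exact .inl ⟨rfl, a, rfl, rfl⟩
  · exact .inr (.inl ⟨w, (a, w), rfl, rfl, rfl⟩)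
  · exact .inr (.inr ⟨w, (a, w), rfl, rfl, rfl⟩)

theorem push (b : Bool) : PT fun s : Str => b :: s :=
  ⟨.push b 0, 1, fun s => (Runs.push_input b (by simp)).mono (by simp)⟩

@[fun_prop]
theorem strCons (b : Bool) {s : α → Str} (hs : PT s) : PT fun a => b :: s a := (push b).comp hs

theorem strTail' : PT fun s : Str => s.tail :=
  ⟨.pop 0, 1, fun s => (Runs.pop_input (by simp)).mono (by simp)⟩

@[fun_prop]
theorem strTail {s : α → Str} (hs : PT s) : PT fun a => (s a).tail := strTail'.comp hs

/-- The encoding, as a string. -/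
theorem encode : PT fun a : α => enc a := of_enc_eq fun _ => rfl

/-- Only the encoding of the values matters. -/
theorem enc_congr {f : α → β} {g : α → γ} (hf : PT f) (h : ∀ a, enc (g a) = enc (f a)) : PT g := by
  obtain ⟨c, p, hf⟩ := hf
  exact ⟨c, p, fun a => by rw [h]; exact hf a⟩

theorem sumCases {s : α → β ⊕ γ} {f : α × β → δ} {g : α × γ → δ} (hs : PT s) (hf : PT f)
    (hg : PT g) : PT fun a => match s a with
      | .inl b => f (a, b)
      | .inr c => g (a, c) := by
  -- The encoding of a sum is never empty, so the first branch is a function on `Empty`, for which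
  -- any program will do.
  refine cases (α' := Empty) (encode.comp hs) (f := Empty.elim) ⟨.skip, 0, Empty.rec⟩ hf hg
    fun a => ?_
  rcases hw : s a with b | c
  · exact .inr (.inl ⟨enc b, (a, b), rfl, rfl, rfl⟩)
  · exact .inr (.inr ⟨enc c, (a, c), rfl, rfl, rfl⟩)

theorem natCases {n : α → ℕ} {f : α → δ} {g : α × ℕ → δ} (hn : PT n) (hf : PT f)
    (hg : PT g) : PT fun a => match n a with
      | 0 => f a
      | n + 1 => g (a, n) := by
  refine cases (encode.comp hn) hf hg hg fun a => ?_
  rcases hw : n a with _ | m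
  · exact .inl ⟨rfl, a, rfl, rfl⟩
  · exact .inr (.inr ⟨enc m, (a, m), rfl, rfl, rfl⟩)

theorem listCases {l : α → List β} {f : α → δ} {g : α × β × List β → δ} (hl : PT l) (hf : PT f)
    (hg : PT g) : PT fun a => match l a with
      | [] => f a
      | b :: l => g (a, b, l) := by
  -- `cases` consumes the bit on which it branches, but the whole encoding of a nonempty list is
  -- needed, being the pair of its head and its tail. Hence an extra bit is put in front.
  have h1 : PT fun a => match enc (l a) with
      | [] => ([] : Str)
      | false :: w => false :: false :: w
      | true :: w => false :: true :: w :=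
    strCases (f := fun _ => []) (g := fun p => false :: false :: p.2)
      (h := fun p => false :: true :: p.2) (encode.comp hl) (by fun_prop) (by fun_prop) (by fun_prop)
  refine cases h1 hf hg hg fun a => ?_
  rcases hw : l a with _ | ⟨b, m⟩
  · exact .inl ⟨by simp [enc_nil], a, rfl, rfl⟩
  · refine .inr (.inl ⟨enc (b :: m), (a, b, m), ?_, rfl, rfl⟩)
    have : ∀ w : Str, w ≠ [] → (match w with
      | [] => ([] : Str)
      | false :: w => false :: false :: w
      | true :: w => false :: true :: w) = false :: w := by
      rintro (_ | ⟨_ | _, w⟩) <;> simp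
    exact this _ (pr_ne_nil _ _)

/-- Iteration with a step that enlarges the state by a polynomial amount. -/
theorem iterate_of_le {n : α → β} {init : α → γ} {step : α × γ → γ} (hn : PT n) (hi : PT init)
    (hs : PT step) (hb : ∃ q : Polynomial ℕ, ∀ a x,
      (enc (step (a, x))).length ≤ (enc x).length + q.eval (enc a).length) :
    PT fun a => (fun x => step (a, x))^[(enc (n a)).length] (init a) := by
  refine iterate hn hi hs ?_
  obtain ⟨q, hq⟩ := hb
  obtain ⟨pi, hpi⟩ := hi.length_enc_le
  obtain ⟨pn, hpn⟩ := hn.length_enc_le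
  refine ⟨pi + pn * q, fun a i hin => ?_⟩
  have : (enc ((fun x => step (a, x))^[i] (init a))).length ≤
      (enc (init a)).length + i * q.eval (enc a).length := by
    clear hin
    induction i with
    | zero => simp
    | succ i ih =>
      rw [Function.iterate_succ_apply']
      have := hq a ((fun x => step (a, x))^[i] (init a))
      rw [Nat.succ_mul]
      omega
  have := hpi a
  have := Nat.mul_le_mul_right (q.eval (enc a).length) (hin.trans (hpn a))
  simp
  omega

theorem iterateNat {n : α → ℕ} {init : α → γ} {step : α × γ → γ} (hn : PT n) (hi : PT init)
    (hs : PT step) (hb : ∃ q : Polynomial ℕ, ∀ a x,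
      (enc (step (a, x))).length ≤ (enc x).length + q.eval (enc a).length) :
    PT fun a => (fun x => step (a, x))^[n a] (init a) :=
  (iterate_of_le hn hi hs hb).congr fun a => by simp [enc_nat]

/-! ### Natural numbers -/

theorem succ' : PT fun n : ℕ => n + 1 :=
  ((push true).comp encode).enc_congr fun _ => rfl

@[fun_prop]
theorem succ {n : α → ℕ} (hn : PT n) : PT fun a => n a + 1 := succ'.comp hn

@[fun_prop]
theorem pred {n : α → ℕ} (hn : PT n) : PT fun a => n a - 1 :=
  (strTail'.comp (encode.comp hn)).enc_congr fun _ => by simp [enc_nat, enc_str]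

@[fun_prop]
theorem size {f : α → β} (hf : PT f) : PT fun a => (enc (f a)).length := by
  refine (iterate_of_le (step := fun p : α × ℕ => p.2 + 1) hf (const 0) (by fun_prop)
    ⟨1, fun a x => by simp [enc_nat]⟩).congr fun a => ?_
  simp

@[fun_prop]
theorem add {m n : α → ℕ} (hm : PT m) (hn : PT n) : PT fun a => m a + n a :=
  (iterateNat (step := fun p : α × ℕ => p.2 + 1) hn hm (by fun_prop)
    ⟨1, fun a x => by simp [enc_nat]⟩).congr fun a => by simp

@[fun_prop]
theorem sub {m n : α → ℕ} (hm : PT m) (hn : PT n) : PT fun a => m a - n a :=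
  (iterateNat (step := fun p : α × ℕ => p.2 - 1) hn hm (by fun_prop)
    ⟨1, fun a x => by simp [enc_nat]; omega⟩).congr fun a => by
      simp [Nat.pred_iterate, show (fun x : ℕ => x - 1) = Nat.pred from rfl]

@[fun_prop]
theorem mul {m n : α → ℕ} (hm : PT m) (hn : PT n) : PT fun a => m a * n a := by
  obtain ⟨p, hp⟩ := hm.length_enc_le
  refine (iterateNat (step := fun q : α × ℕ => q.2 + m q.1) hn (const 0) (by fun_prop)
    ⟨p, fun a x => ?_⟩).congr fun a => ?_
  · have := hp a
    simp [enc_nat] at this ⊢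
    omega
  · simp [Nat.mul_comm]

theorem polynomial (p : Polynomial ℕ) {n : α → ℕ} (hn : PT n) : PT fun a => p.eval (n a) := by
  induction p using Polynomial.induction_on' with
  | add p q hp hq => simpa using hp.add hq
  | monomial k c =>
    simp only [Polynomial.eval_monomial]
    refine (const c).mul ?_
    induction k with
    | zero => simpa using const 1
    | succ k ih => simpa [pow_succ] using ih.mul hn

end PT

/-! ### Decidable predicates -/

open Classical in
/-- The truth value of a proposition, as a string. -/
noncomputable def truth (p : Prop) : Str := if p then [true] else []

/-- The predicate `P` is decidable in polynomial time with respect to the encoding. -/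
@[fun_prop]
def PTP {α : Type} [Enc α] (P : α → Prop) : Prop := PT fun a => truth (P a)

namespace PTP

variable {α β γ : Type} [Enc α] [Enc β] [Enc γ] {P Q : α → Prop}

theorem elim {f g : α → β} {r : α → β} (hP : PTP P) (hf : PT f) (hg : PT g)
    (h1 : ∀ a, P a → r a = f a) (h2 : ∀ a, ¬P a → r a = g a) : PT r := by
  refine PT.cases (β := Empty) (g := Empty.elim) (h := fun p : α × Str => f p.1) hP hg
    ⟨.skip, 0, Empty.rec⟩ (by fun_prop) fun a => ?_
  by_cases h : P a
  · exact .inr (.inr ⟨[], (a, ([] : Str)), by simp [truth, h], rfl, h1 a h⟩)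
  · exact .inl ⟨by simp [truth, h], a, rfl, h2 a h⟩

@[fun_prop]
theorem _root_.PT.ite [∀ a, Decidable (P a)] {f g : α → β} (hP : PTP P) (hf : PT f) (hg : PT g) :
    PT fun a => if P a then f a else g a :=
  hP.elim hf hg (fun _ h => if_pos h) fun _ h => if_neg h

theorem congr (h : PTP P) (hPQ : ∀ a, Q a ↔ P a) : PTP Q := by
  rwa [show Q = P from funext fun a => propext (hPQ a)]

@[fun_prop]
theorem comp {P : β → Prop} {f : α → β} (hP : PTP P) (hf : PT f) : PTP fun a => P (f a) :=
  PT.comp (g := fun b => truth (P b)) hP hf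

@[fun_prop]
theorem not (hP : PTP P) : PTP fun a => ¬P a :=
  PTP.elim (f := fun _ => []) (g := fun _ => [true]) hP (by fun_prop) (by fun_prop)
    (fun _ h => by simp [truth, h]) fun _ h => by simp [truth, h]

@[fun_prop]
theorem and (hP : PTP P) (hQ : PTP Q) : PTP fun a => P a ∧ Q a :=
  PTP.elim (f := fun a => truth (Q a)) (g := fun _ => []) hP hQ (by fun_prop)
    (fun _ h => by simp only [h, true_and]) fun _ h => by simp [truth, h]

@[fun_prop]
theorem or (hP : PTP P) (hQ : PTP Q) : PTP fun a => P a ∨ Q a :=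
  PTP.elim (f := fun _ => [true]) (g := fun a => truth (Q a)) hP (by fun_prop) hQ
    (fun _ h => by simp [truth, h]) fun _ h => by simp only [h, false_or]

@[fun_prop]
theorem iff (hP : PTP P) (hQ : PTP Q) : PTP fun a => P a ↔ Q a :=
  ((hP.and hQ).or (hP.not.and hQ.not)).congr fun _ => by tauto

theorem natEqZero {n : α → ℕ} (hn : PT n) : PTP fun a => n a = 0 :=
  (PT.natCases (f := fun _ => truth True) (g := fun _ => truth False) hn (PT.const _)
    (PT.const _)).congr fun a => by cases h : n a <;> simp [h]

@[fun_prop]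
theorem le {m n : α → ℕ} (hm : PT m) (hn : PT n) : PTP fun a => m a ≤ n a :=
  (natEqZero (hm.sub hn)).congr fun a => by omega

@[fun_prop]
theorem lt {m n : α → ℕ} (hm : PT m) (hn : PT n) : PTP fun a => m a < n a :=
  (le hm.succ hn).congr fun a => by omega

theorem natEq {m n : α → ℕ} (hm : PT m) (hn : PT n) : PTP fun a => m a = n a :=
  ((le hm hn).and (le hn hm)).congr fun a => by omega

theorem strHead {s : α → Str} (hs : PT s) : PTP fun a => (s a).head? = some true :=
  (PT.strCases (f := fun _ => truth False) (g := fun _ => truth False) (h := fun _ => truth True) hs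
    (PT.const _) (PT.const _) (PT.const _)).congr fun a => by
      rcases h : s a with _ | ⟨_ | _, w⟩ <;> simp [h]

theorem strEqNil {s : α → Str} (hs : PT s) : PTP fun a => s a = [] :=
  (PT.strCases (f := fun _ => truth True) (g := fun _ => truth False) (h := fun _ => truth False) hs
    (PT.const _) (PT.const _) (PT.const _)).congr fun a => by
      rcases h : s a with _ | ⟨_ | _, w⟩ <;> simp [h]

end PTP

/-! ### Lists -/

section LengthEnc

variable {α β : Type} [Enc α] [Enc β]

theorem length_enc_pair (a : α) (b : β) :
    (enc (a, b)).length = 2 * (enc a).length + 1 + (enc b).length := length_pr _ _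

theorem length_enc_nat (n : ℕ) : (enc n).length = n := List.length_replicate

theorem length_enc_cons (a : α) (l : List α) :
    (enc (a :: l)).length = 2 * (enc a).length + 1 + (enc l).length := length_pr _ _

theorem length_enc_list (l : List α) :
    (enc l).length = (l.map fun a => 2 * (enc a).length + 1).sum := by
  induction l with
  | nil => rfl
  | cons a l ih => rw [length_enc_cons, ih, List.map_cons, List.sum_cons]

theorem length_enc_append (l m : List α) :
    (enc (l ++ m)).length = (enc l).length + (enc m).length := by
  simp [length_enc_list]

theorem length_enc_drop_le (l : List α) (k : ℕ) : (enc (l.drop k)).length ≤ (enc l).length := by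
  conv_rhs => rw [← List.take_append_drop k l, length_enc_append]
  omega

theorem length_le_length_enc (l : List α) : l.length ≤ (enc l).length := by
  induction l with
  | nil => simp
  | cons a l ih => rw [length_enc_cons, List.length_cons]; omega

theorem length_enc_le_of_mem {a : α} {l : List α} (h : a ∈ l) :
    (enc a).length ≤ (enc l).length := by
  rw [length_enc_list]
  have := List.single_le_sum (l := l.map fun a => 2 * (enc a).length + 1) (by simp) _
    (List.mem_map_of_mem h)
  omega

end LengthEnc

namespace PT

open Polynomial

variable {α β γ δ ε : Type} [Enc α] [Enc β] [Enc γ] [Enc δ] [Enc ε]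

@[fun_prop]
theorem listCons {f : α → β} {l : α → List β} (hf : PT f) (hl : PT l) : PT fun a => f a :: l a :=
  (hf.prodMk hl).enc_congr fun _ => rfl

/-- The fold is an iteration on pairs of accumulator and remaining list. The encoding of the list is
at least as long as the list, and the surplus rounds idle once nothing remains. -/
theorem foldl_of_prefix {l : α → List β} {init : α → γ} {f : α × γ × β → γ} (hl : PT l)
    (hi : PT init) (hf : PT f) (hb : ∃ p : Polynomial ℕ, ∀ a k,
      (enc (((l a).take k).foldl (fun x b => f (a, x, b)) (init a))).length ≤
        p.eval (enc a).length) :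
    PT fun a => (l a).foldl (fun x b => f (a, x, b)) (init a) := by
  obtain ⟨p, hp⟩ := hb
  obtain ⟨q, hq⟩ := hl.length_enc_le
  let step : α × γ × List β → γ × List β := fun t => match t.2.2 with
    | [] => (t.2.1, [])
    | b :: l => (f (t.1, t.2.1, b), l)
  have hstep : PT step := listCases (l := fun t : α × γ × List β => t.2.2)
    (f := fun t => (t.2.1, []))
    (g := fun t : (α × γ × List β) × β × List β => (f (t.1.1, t.1.2.1, t.2.1), t.2.2))
    (by fun_prop) (by fun_prop) (by fun_prop)
  have key : ∀ a i, (fun x => step (a, x))^[i] (init a, l a) =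
      (((l a).take i).foldl (fun x b => f (a, x, b)) (init a), (l a).drop i) := by
    intro a i
    induction i with
    | zero => simp
    | succ i ih =>
      rw [Function.iterate_succ_apply', ih]
      rcases lt_or_ge i (l a).length with h | h
      · simp only [step, List.drop_eq_getElem_cons h, List.take_succ_eq_append_getElem h,
          List.foldl_append, List.foldl_cons, List.foldl_nil]
      · simp [step, List.drop_eq_nil_of_le h, List.take_of_length_le h,
          List.drop_eq_nil_of_le (h.trans (Nat.le_succ i)),
          List.take_of_length_le (h.trans (Nat.le_succ i))]
  have := iterate (n := l) (init := fun a => (init a, l a)) hl (by fun_prop) hstep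
    ⟨2 * p + 1 + q, fun a i _ => by
      rw [key, length_enc_pair]
      have := hp a i
      have := (length_enc_drop_le (l a) i).trans (hq a)
      simp
      omega⟩
  refine (fst.comp this).congr fun a => ?_
  rw [key, List.take_of_length_le (length_le_length_enc _)]

/-- Folding a list with a step that enlarges the state by a polynomial amount. -/
theorem foldl {l : α → List β} {init : α → γ} {f : α × γ × β → γ} (hl : PT l)
    (hi : PT init) (hf : PT f) (hb : ∃ q : Polynomial ℕ, ∀ a x b,
      (enc (f (a, x, b))).length ≤ (enc x).length + q.eval ((enc a).length + (enc b).length)) :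
    PT fun a => (l a).foldl (fun x b => f (a, x, b)) (init a) := by
  obtain ⟨q, hq⟩ := hb
  obtain ⟨pl, hpl⟩ := hl.length_enc_le
  obtain ⟨pi, hpi⟩ := hi.length_enc_le
  refine foldl_of_prefix hl hi hf ⟨pi + pl * q.comp (X + pl), fun a k => ?_⟩
  have main : ∀ (m : List β) (x : γ), (∀ b ∈ m, b ∈ l a) →
      (enc (m.foldl (fun x b => f (a, x, b)) x)).length ≤
        (enc x).length + m.length * q.eval ((enc a).length + pl.eval (enc a).length) := by
    intro m
    induction m with
    | nil => simp
    | cons b m ih =>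
      intro x hm
      have h1 := ih (f (a, x, b)) fun b' hb' => hm b' (by simp [hb'])
      have h2 := hq a x b
      have h3 := q.eval_le_eval_nat (Nat.add_le_add_left
        ((length_enc_le_of_mem (hm b (by simp))).trans (hpl a)) (enc a).length)
      rw [List.foldl_cons, List.length_cons, Nat.succ_mul]
      omega
  have h1 := main ((l a).take k) (init a) fun b hb => List.mem_of_mem_take hb
  have h2 := Nat.mul_le_mul_right (q.eval ((enc a).length + pl.eval (enc a).length))
    (((List.length_take_le' k (l a)).trans (length_le_length_enc _)).trans (hpl a))
  have h3 := hpi a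
  simp [eval_comp]
  omega

@[fun_prop]
theorem reverse {l : α → List β} (hl : PT l) : PT fun a => (l a).reverse :=
  (foldl (f := fun t : α × List β × β => t.2.2 :: t.2.1) hl (const []) (by fun_prop)
    ⟨2 * X + 1, fun a x b => by simp [length_enc_cons]; omega⟩).congr fun a => by simp

theorem foldr {l : α → List β} {init : α → γ} {f : α × β × γ → γ} (hl : PT l)
    (hi : PT init) (hf : PT f) (hb : ∃ q : Polynomial ℕ, ∀ a x b,
      (enc (f (a, b, x))).length ≤ (enc x).length + q.eval ((enc a).length + (enc b).length)) :
    PT fun a => (l a).foldr (fun b x => f (a, b, x)) (init a) :=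
  (foldl (f := fun t : α × γ × β => f (t.1, t.2.2, t.2.1)) hl.reverse hi (by fun_prop) hb).congr
    fun a => by simp

@[fun_prop]
theorem append {l m : α → List β} (hl : PT l) (hm : PT m) : PT fun a => l a ++ m a :=
  (foldr (f := fun t : α × β × List β => t.2.1 :: t.2.2) hl hm (by fun_prop)
    ⟨2 * X + 1, fun a x b => by simp [length_enc_cons]; omega⟩).congr fun a => by simp

theorem map {l : α → List β} {f : α × β → γ} (hl : PT l) (hf : PT f) :
    PT fun a => (l a).map fun b => f (a, b) := by
  obtain ⟨p, hp⟩ := hf.length_enc_le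
  refine (foldr (f := fun t : α × β × List γ => f (t.1, t.2.1) :: t.2.2) hl (const [])
    (by fun_prop) ⟨2 * p.comp (2 * X + 1) + 1, fun a x b => ?_⟩).congr fun a => by
      induction l a <;> simp_all
  have h1 := hp (a, b)
  have h2 := p.eval_le_eval_nat
    (show (enc (a, b)).length ≤ 2 * ((enc a).length + (enc b).length) + 1 by
      rw [length_enc_pair]; omega)
  simp [length_enc_cons, eval_comp]
  omega

theorem flatMap {l : α → List β} {f : α × β → List γ} (hl : PT l) (hf : PT f) :
    PT fun a => (l a).flatMap fun b => f (a, b) := by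
  obtain ⟨p, hp⟩ := hf.length_enc_le
  refine (foldr (f := fun t : α × β × List γ => f (t.1, t.2.1) ++ t.2.2) hl (const [])
    (by fun_prop) ⟨p.comp (2 * X + 1), fun a x b => ?_⟩).congr fun a => by
      induction l a <;> simp_all
  have h1 := hp (a, b)
  have h2 := p.eval_le_eval_nat
    (show (enc (a, b)).length ≤ 2 * ((enc a).length + (enc b).length) + 1 by
      rw [length_enc_pair]; omega)
  simp [length_enc_append, eval_comp]
  omega

@[fun_prop]
theorem listLength {l : α → List β} (hl : PT l) : PT fun a => (l a).length :=
  (foldl (f := fun t : α × ℕ × β => t.2.1 + 1) hl (const 0) (by fun_prop)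
    ⟨1, fun a x b => by simp [length_enc_nat]⟩).congr fun a => by
      rw [List.foldl_add_const]; simp

@[fun_prop]
theorem listTail {l : α → List β} (hl : PT l) : PT fun a => (l a).tail :=
  (listCases (f := fun _ => []) (g := fun t => t.2.2) hl (by fun_prop) (by fun_prop)).congr
    fun a => by cases l a <;> rfl

theorem listHeadD {l : α → List β} {f : α → β} (hl : PT l) (hf : PT f) :
    PT fun a => (l a).headD (f a) :=
  (listCases (g := fun t => t.2.1) hl hf (by fun_prop)).congr
    fun a => by cases l a <;> rfl

theorem drop {n : α → ℕ} {l : α → List β} (hn : PT n) (hl : PT l) : PT fun a => (l a).drop (n a) :=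
  (iterateNat (step := fun t : α × List β => t.2.tail) hn hl (by fun_prop)
    ⟨0, fun a x => by simpa [← List.drop_one] using length_enc_drop_le x 1⟩).congr
    fun a => (List.tail_iterate _ _).symm

theorem getD {n : α → ℕ} {l : α → List β} {f : α → β} (hl : PT l) (hn : PT n) (hf : PT f) :
    PT fun a => (l a).getD (n a) (f a) :=
  (listHeadD (drop hn hl) hf).congr fun a => by simp [List.getD, List.headD_eq_head?_getD]

theorem listTake {n : α → ℕ} {l : α → List β} (hn : PT n) (hl : PT l) :
    PT fun a => (l a).take (n a) := by
  have := drop ((hl.listLength).sub hn) hl.reverse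
  refine this.reverse.congr fun a => ?_
  rw [List.drop_reverse, List.reverse_reverse]
  rcases le_total (n a) (l a).length with h | h
  · rw [Nat.sub_sub_self h]
  · rw [List.take_of_length_le h, List.take_of_length_le (by omega)]

theorem set {n : α → ℕ} {l : α → List β} {f : α → β} (hl : PT l) (hn : PT n) (hf : PT f) :
    PT fun a => (l a).set (n a) (f a) := by
  refine (PT.ite (P := fun a => n a < (l a).length) (by fun_prop)
    ((listTake hn hl).append (hf.listCons (drop hn.succ hl))) hl).congr fun a => ?_
  split_ifs with h
  · rw [List.set_eq_take_append_cons_drop, if_pos h]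
  · rw [List.set_eq_of_length_le (by omega)]

/-- The length of the list built so far is the next number to be added, so no separate counter is
carried. -/
theorem range {n : α → ℕ} (hn : PT n) : PT fun a => List.range (n a) := by
  have key : ∀ i, (fun l : List ℕ => l.length :: l)^[i] [] = (List.range i).reverse := by
    intro i
    induction i with
    | zero => rfl
    | succ i ih => simp only [Function.iterate_succ_apply', ih, List.range_succ]; simp
  obtain ⟨p, hp⟩ := hn.length_enc_le
  have := iterate (step := fun t : α × List ℕ => t.2.length :: t.2) hn (const []) (by fun_prop)
    ⟨p * (2 * p + 1), fun a i hi => by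
      rw [key, length_enc_list]
      refine (List.sum_le_card_nsmul _ (2 * p.eval (enc a).length + 1) ?_).trans ?_
      · simp only [List.mem_map, List.mem_reverse, List.mem_range, length_enc_nat]
        have := hi.trans (hp a)
        rintro _ ⟨j, hj, rfl⟩
        omega
      · have := Nat.mul_le_mul_right (2 * p.eval (enc a).length + 1) (hi.trans (hp a))
        simpa using this⟩
  refine this.reverse.congr fun a => ?_
  rw [key, List.reverse_reverse, length_enc_nat]

@[fun_prop]
theorem replicate {n : α → ℕ} (b : β) (hn : PT n) : PT fun a => List.replicate (n a) b :=
  (iterateNat (step := fun t : α × List β => b :: t.2) hn (const []) (by fun_prop)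
    ⟨Polynomial.C (2 * (enc b).length + 1), fun a x => by
      simp [length_enc_cons]; omega⟩).congr fun a => by
        generalize n a = m
        induction m with
        | zero => rfl
        | succ m ih => rw [Function.iterate_succ_apply', ← ih, List.replicate_succ]

/-! ### Strings -/

/-- The list of the bits of a string. -/
def _root_.Str.chars (s : Str) : List Str := s.map fun b => [b]

/-- The string of the bits with which the items begin. -/
def _root_.Str.ofChars (l : List Str) : Str := l.map fun s => s.headD false

-- A string is its own encoding and not a list of encoded items. The list operations reach it only
-- through this conversion and its inverse `Str.ofChars`.
@[fun_prop]
theorem chars {s : α → Str} (hs : PT s) : PT fun a => (s a).chars := by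
  let step : α × List Str × Str → List Str × Str := fun t => match t.2.2 with
    | [] => (t.2.1, [])
    | false :: w => ([false] :: t.2.1, w)
    | true :: w => ([true] :: t.2.1, w)
  have hstep : PT step := strCases (s := fun t : α × List Str × Str => t.2.2)
    (f := fun t => (t.2.1, []))
    (g := fun t : (α × List Str × Str) × Str => ([false] :: t.1.2.1, t.2))
    (h := fun t : (α × List Str × Str) × Str => ([true] :: t.1.2.1, t.2))
    (by fun_prop) (by fun_prop) (by fun_prop) (by fun_prop)
  have := iterate_of_le (n := s) (init := fun a => ([], s a)) hs (by fun_prop) hstep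
    ⟨6, fun a x => by
      rcases x with ⟨x, _ | ⟨_ | _, w⟩⟩ <;>
        simp [step, length_enc_pair, length_enc_cons, enc_str] <;> omega⟩
  have key : ∀ a (w : Str) (l : List Str), (fun x => step (a, x))^[w.length] (l, w) =
      (w.chars.reverse ++ l, []) := by
    intro a w
    induction w with
    | nil => intro l; rfl
    | cons b w ih =>
      intro l
      rw [List.length_cons, Function.iterate_succ_apply]
      cases b <;> simp [step, ih, Str.chars]
  refine (fst.comp this).reverse.congr fun a => ?_
  rw [enc_str, key]
  simp

theorem listToStr {l : α → List β} {P : α × β → Prop} [∀ a, Decidable (P a)] (hl : PT l)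
    (hP : PTP P) : PT fun a => ((l a).map fun b => decide (P (a, b)) : Str) :=
  (foldr (f := fun t : α × β × Str => if P (t.1, t.2.1) then true :: t.2.2 else false :: t.2.2)
    hl (const []) (by fun_prop) ⟨1, fun a x b => by
      dsimp only; split_ifs <;> simp [enc_str]⟩).congr fun a => by
        induction l a with
        | nil => rfl
        | cons b l ih =>
          rw [List.foldr_cons, ← ih, List.map_cons]
          split_ifs with h <;> simp [h]

@[fun_prop]
theorem ofChars {l : α → List Str} (hl : PT l) : PT fun a => Str.ofChars (l a) :=
  (listToStr (P := fun t : α × Str => t.2.head? = some true) hl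
    (PTP.strHead (by fun_prop))).congr fun a => by
      refine List.map_congr_left fun s _ => ?_
      rcases s with _ | ⟨_ | _, s⟩ <;> simp

@[fun_prop]
theorem strAppend {s t : α → Str} (hs : PT s) (ht : PT t) : PT fun a => s a ++ t a :=
  ((chars hs).append (chars ht)).ofChars.congr fun a => by
    simp [Str.chars, Str.ofChars, Function.comp_def]

@[fun_prop]
theorem strReplicate {n : α → ℕ} (b : Bool) (hn : PT n) :
    PT fun a => (List.replicate (n a) b : Str) :=
  ((replicate [b] hn).ofChars).congr fun a => by
    simp [Str.ofChars]

theorem strDrop {n : α → ℕ} {s : α → Str} (hn : PT n) (hs : PT s) : PT fun a => (s a).drop (n a) :=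
  (iterateNat (step := fun t : α × Str => t.2.tail) hn hs (by fun_prop)
    ⟨0, fun a x => by simp [enc_str]⟩).congr
    fun a => (List.tail_iterate _ _).symm

@[fun_prop]
theorem strLength {s : α → Str} (hs : PT s) : PT fun a => (s a).length := size hs

theorem strDropWhile (b : Bool) {s : α → Str} (hs : PT s) :
    PT fun a => (s a).dropWhile (· == b) := by
  let step : α × Str → Str := fun t => if t.2.head? = some b then t.2.tail else t.2
  have hstep : PT step := by
    refine PT.ite ?_ (by fun_prop) (by fun_prop)
    cases b
    · exact ((PTP.strHead (s := fun t : α × Str => t.2) (by fun_prop)).or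
        (PTP.strEqNil (s := fun t : α × Str => t.2) (by fun_prop))).not.congr fun t => by
          rcases t.2 with _ | ⟨_ | _, w⟩ <;> simp
    · exact PTP.strHead (by fun_prop)
  refine (iterate_of_le hs hs hstep ⟨0, fun a x => by
    dsimp only [step]; split_ifs <;> simp [enc_str]⟩).congr fun a => ?_
  have key : ∀ (w : Str) (n : ℕ), w.length ≤ n →
      (fun x => step (a, x))^[n] w = w.dropWhile (· == b) := by
    intro w n
    induction n generalizing w with
    | zero => intro h; simp_all
    | succ n ih =>
      intro h
      rw [Function.iterate_succ_apply]
      rcases w with _ | ⟨c, w⟩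
      · rw [ih _ (by simp [step])]
        simp [step]
      · rw [List.dropWhile_cons]
        by_cases hc : c = b
        · subst hc
          simp only [List.length_cons] at h
          simp [step, ih w (by omega)]
        · have : step (a, c :: w) = c :: w := by simp [step, hc]
          rw [this, Function.iterate_fixed this]
          simp [hc]
  exact (key _ _ le_rfl).symm

end PT

namespace PTP

variable {α β γ : Type} [Enc α] [Enc β] [Enc γ] {P Q : α → Prop}

/-- Equal first bits are cancelled until the strings differ, at which point the state freezes. The
strings are equal precisely when both are used up. -/
theorem strEq {s t : α → Str} (hs : PT s) (ht : PT t) : PTP fun a => s a = t a := by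
  let step : α × Str × Str → Str × Str := fun x =>
    if x.2.1 ≠ [] ∧ x.2.2 ≠ [] ∧ (x.2.1.head? = some true ↔ x.2.2.head? = some true) then
      (x.2.1.tail, x.2.2.tail) else x.2
  have hstep : PT step := by
    refine PT.ite ?_ (by fun_prop) (by fun_prop)
    exact (strEqNil (s := fun x : α × Str × Str => x.2.1) (by fun_prop)).not.and
      ((strEqNil (s := fun x : α × Str × Str => x.2.2) (by fun_prop)).not.and
        ((strHead (s := fun x : α × Str × Str => x.2.1) (by fun_prop)).iff
          (strHead (s := fun x : α × Str × Str => x.2.2) (by fun_prop))))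
  have h := PT.iterate_of_le (n := s) (init := fun a => (s a, t a)) hs (by fun_prop) hstep
    ⟨0, fun a ⟨x, y⟩ => by
      dsimp only [step]
      split_ifs
      · simp [length_enc_pair, enc_str]; omega
      · simp⟩
  have key : ∀ a (s t : Str),
      (fun x => step (a, x))^[s.length] (s, t) = ([], []) ↔ s = t := by
    intro a s
    induction s with
    | nil => intro t; simp [eq_comm]
    | cons b s ih =>
      intro t
      rw [List.length_cons, Function.iterate_succ_apply]
      by_cases h : ∃ t', t = b :: t'
      · obtain ⟨t', rfl⟩ := h
        simp [step, ih]
      · have : step (a, b :: s, t) = (b :: s, t) := by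
          rcases t with _ | ⟨c, t⟩
          · simp [step]
          · cases b <;> cases c <;> simp_all [step]
        rw [this, Function.iterate_fixed this]
        simp only [Prod.mk.injEq, reduceCtorEq, false_and, false_iff]
        rintro rfl
        exact h ⟨_, rfl⟩
  refine ((strEqNil h.fst_comp).and (strEqNil h.snd_comp)).congr fun a => ?_
  rw [← key a, enc_str, Prod.ext_iff]

theorem strGetD {s : α → Str} {n : α → ℕ} (hs : PT s) (hn : PT n) :
    PTP fun a => (s a).getD (n a) false = true :=
  (strHead (PT.strDrop hn hs)).congr fun a => by
    simp [List.getD, Option.getD_eq_iff]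

end PTP

/-! ### Sink-of-DAG is in TFNP -/

/-- Numbers in unary notation. -/
def parseNat (s : Str) : ℕ × Str :=
  (s.length - (s.dropWhile (· == true)).length, (s.dropWhile (· == true)).tail)

/-- Parse an item of the first kind and then an item of the second kind. -/
def parsePair {α β : Type} (p : Str → α × Str) (q : Str → β × Str) (s : Str) : (α × β) × Str :=
  (((p s).1, (q (p s).2).1), (q (p s).2).2)

/-- Parse one more item of a list. -/
def parseStep {α : Type} (p : Str → α × Str) (t : List α × Str) : List α × Str :=
  if t.2.head? = some true then ((p t.2.tail).1 :: t.1, (p t.2.tail).2) else t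

/-- Parse a list. -/
def parseList {α : Type} (p : Str → α × Str) (s : Str) : List α × Str :=
  (((parseStep p)^[s.length] ([], s)).1.reverse, ((parseStep p)^[s.length] ([], s)).2.tail)

section Parse

variable {α β : Type} [Enc α] [Enc β]

theorem parseNat_encNat (k : ℕ) (s : Str) : parseNat (encNat k ++ s) = (k, s) := by
  have : (encNat k ++ s).dropWhile (· == true) = false :: s := by
    cases k <;> simp [encNat, List.replicate_succ]
  rw [parseNat, this]
  simp [encNat]

omit [Enc α] [Enc β] in
theorem parsePair_append {e : α → Str} {e' : β → Str} {p : Str → α × Str} {q : Str → β × Str}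
    (hp : ∀ a s, p (e a ++ s) = (a, s)) (hq : ∀ b s, q (e' b ++ s) = (b, s)) (a : α) (b : β)
    (s : Str) : parsePair p q (e a ++ e' b ++ s) = ((a, b), s) := by
  simp [parsePair, hp, hq]

omit [Enc α] in
-- There are at least as many rounds as items, because every item is announced by a bit. The final
-- `0` of the list stops the parser, and further rounds change nothing.
theorem parseList_encList {e : α → Str} {p : Str → α × Str}
    (hp : ∀ a s, p (e a ++ s) = (a, s)) (l : List α) (s : Str) :
    parseList p (encList e l ++ s) = (l, s) := by
  have key : ∀ (l acc : List α) (n : ℕ), l.length ≤ n →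
      (parseStep p)^[n] (acc, encList e l ++ s) = (l.reverse ++ acc, false :: s) := by
    intro l
    induction l with
    | nil =>
      intro acc n _
      exact Function.iterate_fixed (by simp [parseStep, encList]) n
    | cons a l ih =>
      intro acc n hn
      obtain ⟨n, rfl⟩ : ∃ m, n = m + 1 := ⟨n - 1, by simp at hn; omega⟩
      have : parseStep p (acc, encList e (a :: l) ++ s) = (a :: acc, encList e l ++ s) := by
        simp [parseStep, encList, hp]
      rw [Function.iterate_succ_apply, this, ih _ _ (by simpa using hn)]
      simp
  have hl : ∀ l : List α, l.length ≤ (encList e l).length := by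
    intro l
    induction l with
    | nil => simp
    | cons a l ih => simp [encList]; omega
  rw [parseList, key _ _ _ (by have := hl l; simp; omega)]
  simp

theorem length_parseNat_le (s : Str) : (parseNat s).2.length ≤ s.length := by
  have := (List.dropWhile_suffix (l := s) (· == true)).length_le
  simp only [parseNat, List.length_tail]
  omega

omit [Enc α] [Enc β] in
theorem length_parsePair_le {p : Str → α × Str} {q : Str → β × Str}
    (hp : ∀ s, (p s).2.length ≤ s.length) (hq : ∀ s, (q s).2.length ≤ s.length) (s : Str) :
    (parsePair p q s).2.length ≤ s.length :=
  (hq _).trans (hp _)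

omit [Enc α] in
theorem length_parseStep_le {p : Str → α × Str} (hp : ∀ s, (p s).2.length ≤ s.length)
    (t : List α × Str) : (parseStep p t).2.length ≤ t.2.length := by
  rw [parseStep]
  split_ifs
  · have := hp t.2.tail
    simp at this ⊢
    omega
  · rfl

omit [Enc α] in
theorem length_parseStep_iterate_le {p : Str → α × Str} (hp : ∀ s, (p s).2.length ≤ s.length)
    (n : ℕ) (t : List α × Str) : ((parseStep p)^[n] t).2.length ≤ t.2.length := by
  induction n with
  | zero => rfl
  | succ n ih =>
    rw [Function.iterate_succ_apply']
    exact (length_parseStep_le hp _).trans ih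

theorem PT.parseNat : PT parseNat :=
  have h := PT.strDropWhile true (PT.id (α := Str))
  (PT.sub (by fun_prop) (h.strLength)).prodMk (strTail h)

theorem PT.parsePair {p : Str → α × Str} {q : Str → β × Str} (hp : PT p) (hq : PT q) :
    PT (parsePair p q) := by
  unfold _root_.parsePair
  fun_prop

/-- Since `p` never lengthens the rest, every item is parsed from a string no longer than the input.
All items therefore obey one polynomial bound, and the state does not explode. -/
theorem PT.parseList {p : Str → α × Str} (hp : PT p) (hle : ∀ s, (p s).2.length ≤ s.length) :
    PT (parseList p) := by
  obtain ⟨q, hq⟩ := hp.length_enc_le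
  have hstep : PT (parseStep p) := by
    refine PT.ite (PTP.strHead (by fun_prop)) (by fun_prop) (by fun_prop)
  have key : ∀ (s : Str) (i : ℕ), (enc ((parseStep p)^[i] ([], s)).1).length ≤
      i * (2 * q.eval s.length + 1) := by
    intro s i
    induction i with
    | zero => simp [enc_nil]
    | succ i ih =>
      rw [Function.iterate_succ_apply']
      have h1 := length_parseStep_iterate_le hle i ([], s)
      generalize (parseStep p)^[i] ([], s) = t at ih h1 ⊢
      rw [Nat.succ_mul, parseStep]
      split_ifs
      · have h2 := hq t.2.tail
        have h3 := q.eval_le_eval_nat (show (enc t.2.tail).length ≤ s.length by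
          simp [enc_str] at h1 ⊢; omega)
        rw [length_enc_pair] at h2
        rw [length_enc_cons]
        omega
      · omega
  have := PT.iterate (n := fun s : Str => s) (init := fun s : Str => (([] : List α), s))
    (step := fun t : Str × List α × Str => parseStep p t.2) (by fun_prop) (by fun_prop)
    (by fun_prop) ⟨2 * (Polynomial.X * (2 * q + 1)) + 1 + Polynomial.X, fun s i hi => by
      have h1 := key s i
      have h2 : _ ≤ s.length := length_parseStep_iterate_le hle i ([], s)
      have h3 := Nat.mul_le_mul_right (2 * q.eval s.length + 1) hi
      change (enc ((parseStep p)^[i] ([], s))).length ≤ _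
      rw [length_enc_pair]
      simp only [enc_str, Polynomial.eval_add, Polynomial.eval_mul, Polynomial.eval_X,
        Polynomial.eval_one, Polynomial.eval_ofNat] at h1 h2 h3 ⊢
      omega⟩
  exact this.fst_comp.reverse.prodMk (this.snd_comp.strTail)

/-- Encodings of lists. -/
theorem PT.encList {γ : Type} [Enc γ] {f : α → Str} {l : γ → List α} (hf : PT f) (hl : PT l) :
    PT fun a => encList f (l a) := by
  obtain ⟨p, hp⟩ := hf.length_enc_le
  refine (PT.foldr (f := fun t : γ × α × Str => true :: (f t.2.1 ++ t.2.2)) hl (PT.const [false])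
    (by fun_prop) ⟨p + 1, fun a x b => ?_⟩).congr fun a => ?_
  · have h1 := hp b
    have h2 := p.eval_le_eval_nat (Nat.le_add_left (enc b).length (enc a).length)
    simp [enc_str] at h1 ⊢
    omega
  · induction l a with
    | nil => rfl
    | cons b l ih => rw [List.foldr_cons, ← ih]; rfl

end Parse

theorem PT.encNat : PT encNat := by
  unfold _root_.encNat
  fun_prop

/-! ### Evaluating, encoding and decoding circuits in polynomial time -/

instance : Enc Circuit := ⟨fun C => enc (C.gates, C.outs)⟩

instance : Enc DAGInstance := ⟨fun I => enc (I.succ, I.val)⟩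

namespace PT

variable {α : Type} [Enc α]

@[fun_prop]
theorem gates {C : α → Circuit} (hC : PT C) : PT fun a => (C a).gates :=
  (of_enc_eq (f := fun C : Circuit => (C.gates, C.outs)) fun _ => rfl).comp hC |>.fst_comp

@[fun_prop]
theorem outs {C : α → Circuit} (hC : PT C) : PT fun a => (C a).outs :=
  (of_enc_eq (f := fun C : Circuit => (C.gates, C.outs)) fun _ => rfl).comp hC |>.snd_comp

@[fun_prop]
theorem circuitMk {g : α → List (ℕ × ℕ)} {o : α → List ℕ} (hg : PT g) (ho : PT o) :
    PT fun a => (⟨g a, o a⟩ : Circuit) :=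
  (hg.prodMk ho).enc_congr fun _ => rfl

@[fun_prop]
theorem dagSucc {I : α → DAGInstance} (hI : PT I) : PT fun a => (I a).succ :=
  (of_enc_eq (f := fun I : DAGInstance => (I.succ, I.val)) fun _ => rfl).comp hI |>.fst_comp

@[fun_prop]
theorem dagVal {I : α → DAGInstance} (hI : PT I) : PT fun a => (I a).val :=
  (of_enc_eq (f := fun I : DAGInstance => (I.succ, I.val)) fun _ => rfl).comp hI |>.snd_comp

@[fun_prop]
theorem dagMk {S V : α → Circuit} (hS : PT S) (hV : PT V) :
    PT fun a => (⟨S a, V a⟩ : DAGInstance) :=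
  (hS.prodMk hV).enc_congr fun _ => rfl

theorem circuitEncode {C : α → Circuit} (hC : PT C) : PT fun a => (C a).encode := by
  refine strAppend (encList ?_ (by fun_prop)) (encList encNat (by fun_prop))
  exact (encNat.comp fst).strAppend (encNat.comp snd)

theorem dagEncode {I : α → DAGInstance} (hI : PT I) : PT fun a => (I a).encode :=
  (circuitEncode (by fun_prop)).strAppend (circuitEncode (by fun_prop))

theorem wires {C : α → Circuit} {v : α → Str} (hC : PT C) (hv : PT v) :
    PT fun a => (C a).wires (v a) := by
  refine (foldl (f := fun t : α × Str × ℕ × ℕ =>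
    if t.2.1.getD t.2.2.1 false = true ∧ t.2.1.getD t.2.2.2 false = true then t.2.1 ++ [false]
    else t.2.1 ++ [true]) hC.gates hv ?_ ⟨1, fun a x b => ?_⟩).congr fun a => ?_
  · exact PT.ite ((PTP.strGetD (by fun_prop) (by fun_prop)).and
      (PTP.strGetD (by fun_prop) (by fun_prop))) (by fun_prop) (by fun_prop)
  · dsimp only
    split_ifs <;> simp [enc_str]
  · rw [Circuit.wires]
    congr 1
    funext w g
    cases h : w.getD g.1 false <;> cases h' : w.getD g.2 false <;> simp_all

theorem eval {C : α → Circuit} {v : α → Str} (hC : PT C) (hv : PT v) :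
    PT fun a => (C a).eval (v a) :=
  (listToStr (P := fun t : α × ℕ => ((C t.1).wires (v t.1)).getD t.2 false = true) hC.outs
    (PTP.strGetD (wires (by fun_prop) (by fun_prop)) (by fun_prop))).congr fun a => by
      simp [Circuit.eval]

end PT

/-- Sloppy decoding of circuits. -/
def Circuit.parse (s : Str) : Circuit × Str :=
  let t := parsePair (parseList (parsePair parseNat parseNat)) (parseList parseNat) s
  (⟨t.1.1, t.1.2⟩, t.2)

/-- Sloppy decoding of instances of Sink-of-DAG. -/
def DAGInstance.decode (s : Str) : DAGInstance :=
  let t := parsePair Circuit.parse Circuit.parse s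
  ⟨t.1.1, t.1.2⟩

theorem Circuit.parse_encode (C : Circuit) (s : Str) : parse (C.encode ++ s) = (C, s) := by
  simp only [parse, encode]
  rw [parsePair_append (e := encList fun g : ℕ × ℕ => encNat g.1 ++ encNat g.2)
    (e' := encList encNat) (parseList_encList fun g s => by
      exact parsePair_append parseNat_encNat parseNat_encNat g.1 g.2 s)
    (parseList_encList parseNat_encNat)]

theorem DAGInstance.decode_encode (I : DAGInstance) : decode I.encode = I := by
  have := parsePair_append Circuit.parse_encode Circuit.parse_encode I.succ I.val []
  rw [List.append_nil] at this
  simp only [decode, encode, this]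

theorem PT.circuitParse : PT Circuit.parse := by
  have h := (PT.parseList (PT.parsePair PT.parseNat PT.parseNat)
    (length_parsePair_le length_parseNat_le length_parseNat_le)).parsePair
    (PT.parseList PT.parseNat length_parseNat_le)
  unfold Circuit.parse
  fun_prop

theorem PT.dagDecode : PT DAGInstance.decode := by
  have h := PT.circuitParse.parsePair PT.circuitParse
  unfold DAGInstance.decode
  fun_prop

/-! ### Comparing values and recognising solutions -/

theorem toNum_cons (b : Bool) (v : Str) : Str.toNum (b :: v) = b.toNat + 2 * Str.toNum v := by
  simp [Str.toNum, Nat.ofDigits_cons]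

theorem PTP.toNum_le {α : Type} [Enc α] {s t : α → Str} (hs : PT s) (ht : PT t)
    (hst : ∀ a, (s a).length = (t a).length) :
    PTP fun a => Str.toNum (s a) ≤ Str.toNum (t a) := by
  let step : α × Str × Str × Str → Str × Str × Str := fun x =>
    if x.2.2.1.head? = some true ↔ x.2.2.2.head? = some true then
      (x.2.1, x.2.2.1.tail, x.2.2.2.tail)
    else (truth (x.2.2.2.head? = some true), x.2.2.1.tail, x.2.2.2.tail)
  have h2 : PTP fun x : α × Str × Str × Str => x.2.2.2.head? = some true :=
    PTP.strHead (by fun_prop)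
  have hstep : PT step := by
    refine PT.ite ((PTP.strHead (by fun_prop)).iff h2) (by fun_prop) ?_
    exact PT.prodMk h2 (by fun_prop)
  have h := PT.iterate_of_le (n := s) (init := fun a => (truth True, s a, t a)) hs (by fun_prop)
    hstep ⟨2, fun a ⟨f, x, y⟩ => by
      dsimp only [step]
      split_ifs
      · simp [length_enc_pair, enc_str]; omega
      · have : (truth (y.head? = some true)).length ≤ 1 := by
          unfold truth; split_ifs <;> simp
        simp [length_enc_pair, enc_str]; omega⟩
  -- The least significant bit comes first: `f` is the verdict of the bits read so far, and it
  -- counts only if all later bits agree.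
  have key : ∀ a (f : Prop) (s t : Str), s.length = t.length →
      (fun x => step (a, x))^[s.length] (truth f, s, t) =
        (truth (Str.toNum s < Str.toNum t ∨ Str.toNum s = Str.toNum t ∧ f), [], []) := by
    intro a f s
    induction s generalizing f with
    | nil =>
      intro t h
      obtain rfl : t = [] := List.length_eq_zero_iff.1 h.symm
      simp
    | cons b s ih =>
      rintro (_ | ⟨c, t⟩) h
      · simp at h
      · rw [List.length_cons, Function.iterate_succ_apply]
        simp only [List.length_cons, Nat.add_right_cancel_iff] at h
        have : step (a, truth f, b :: s, c :: t) =
            (truth (b = c ∧ f ∨ b = false ∧ c = true), s, t) := by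
          cases b <;> cases c <;> simp [step]
        rw [this, ih _ t h, toNum_cons, toNum_cons]
        congr 2
        apply propext
        cases b <;> cases c <;> simp <;> omega
  refine ((PTP.strEqNil h.fst_comp).not).congr fun a => ?_
  rw [enc_str, key a _ _ _ (hst a)]
  by_cases h : Str.toNum (s a) ≤ Str.toNum (t a)
  · simp [truth, ← le_iff_lt_or_eq, h]
  · simp [truth, ← le_iff_lt_or_eq, h]

theorem PTP.dagValid : PTP DAGInstance.Valid := by
  have h0 : PT DAGInstance.dim := by unfold DAGInstance.dim; fun_prop
  have h1 : PT DAGInstance.origin := by unfold DAGInstance.origin; fun_prop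
  exact (PTP.natEq (by fun_prop) h0).and (PTP.strEq (PT.eval (by fun_prop) h1) h1).not

theorem PTP.dagIsSolution : PTP fun t : DAGInstance × Str => t.1.IsSolution t.2 := by
  have h0 : PT fun t : DAGInstance × Str => t.1.dim := by unfold DAGInstance.dim; fun_prop
  have h1 : PT fun t : DAGInstance × Str => t.1.succ.eval t.2 :=
    PT.eval (by fun_prop) (by fun_prop)
  have h2 : PT fun t : DAGInstance × Str => t.1.succ.eval (t.1.succ.eval t.2) :=
    PT.eval (by fun_prop) h1
  have h3 : PT fun t : DAGInstance × Str => t.1.val.eval (t.1.succ.eval t.2) :=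
    PT.eval (by fun_prop) h1
  have h4 : PT fun t : DAGInstance × Str => t.1.val.eval t.2 :=
    PT.eval (by fun_prop) (by fun_prop)
  exact (PTP.natEq (by fun_prop) h0).and ((PTP.strEq h1 (by fun_prop)).not.and
    ((PTP.strEq h2 h1).or (PTP.toNum_le h3 h4 fun t => by simp [Circuit.eval])))

/-- Among the finitely many vertices that are not fixed points, the origin being one, take one of
maximal value. Its successor is a fixed point or does not exceed it. -/
theorem DAGInstance.Valid.exists_isSolution {I : DAGInstance} (h : I.Valid) :
    ∃ v, I.IsSolution v := by
  have hfin : {v : Str | v.length = I.dim ∧ I.succ.eval v ≠ v}.Finite :=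
    (List.finite_length_eq Bool I.dim).subset fun v hv => hv.1
  obtain ⟨v, ⟨hv1, hv2⟩, hv⟩ := hfin.exists_maximalFor (fun v => Str.toNum (I.val.eval v)) _
    ⟨I.origin, by simp [DAGInstance.origin], h.2⟩
  refine ⟨v, hv1, hv2, or_iff_not_imp_left.2 fun hne => ?_⟩
  have hmem : I.succ.eval v ∈ {v : Str | v.length = I.dim ∧ I.succ.eval v ≠ v} :=
    ⟨by simp [Circuit.eval, DAGInstance.dim], hne⟩
  rcases le_total (Str.toNum (I.val.eval (I.succ.eval v))) (Str.toNum (I.val.eval v)) with hle | hle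
  · exact hle
  · exact hv hmem hle

/-- The string encodes a valid instance of Sink-of-DAG. -/
def IsDAG (x : Str) : Prop := (DAGInstance.decode x).encode = x ∧ (DAGInstance.decode x).Valid

/-- Decoding never fails, so codes are recognised by encoding the result again. Valid instances
always have solutions, so the promise in the completion amounts to the decidable `IsDAG`. -/
theorem sinkOfDAG_iff (x y : Str) : SinkOfDAG x y ↔
    IsDAG x ∧ (DAGInstance.decode x).IsSolution y ∨ ¬IsDAG x ∧ y = [] := by
  have h : ∀ y, (∃ I : DAGInstance, I.Valid ∧ x = I.encode ∧ I.IsSolution y) ↔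
      IsDAG x ∧ (DAGInstance.decode x).IsSolution y := by
    intro y
    constructor
    · rintro ⟨I, h1, rfl, h2⟩
      rw [IsDAG, DAGInstance.decode_encode]
      exact ⟨⟨rfl, h1⟩, h2⟩
    · rintro ⟨⟨h1, h2⟩, h3⟩
      exact ⟨_, h2, h1.symm, h3⟩
  simp only [SinkOfDAG, SearchProblem.completion, SearchProblem.dom, Set.mem_ofPred_eq, h]
  refine or_congr Iff.rfl (and_congr (not_congr ⟨fun ⟨y, hy⟩ => hy.1, fun hx => ?_⟩) Iff.rfl)
  obtain ⟨y, hy⟩ := hx.2.exists_isSolution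
  exact ⟨y, hx, hy⟩

theorem PTP.sinkOfDAG : PTP fun t : Str × Str => SinkOfDAG t.1 t.2 := by
  have hd : PTP fun t : Str × Str => IsDAG t.1 := by
    have h := PT.dagDecode
    exact (PTP.strEq (PT.dagEncode (by fun_prop)) (by fun_prop)).and
      (PTP.dagValid.comp (by fun_prop))
  have hs : PTP fun t : Str × Str => (DAGInstance.decode t.1).IsSolution t.2 :=
    PTP.dagIsSolution.comp (f := fun t : Str × Str => (DAGInstance.decode t.1, t.2))
      ((PT.dagDecode.comp PT.fst).prodMk PT.snd)
  exact ((hd.and hs).or (hd.not.and (PTP.strEqNil (by fun_prop)))).congr fun t =>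
    sinkOfDAG_iff t.1 t.2

theorem sinkOfDAG_total (x : Str) : ∃ y, SinkOfDAG x y := by
  simp only [sinkOfDAG_iff]
  by_cases h : IsDAG x
  · obtain ⟨y, hy⟩ := h.2.exists_isSolution
    exact ⟨y, .inl ⟨h, hy⟩⟩
  · exact ⟨[], .inr ⟨h, rfl⟩⟩

theorem length_le_length_encList {α : Type} (e : α → Str) (l : List α) :
    l.length ≤ (encList e l).length := by
  induction l with
  | nil => simp
  | cons a l ih => simp [encList]; omega

theorem length_le_of_sinkOfDAG {x y : Str} (h : SinkOfDAG x y) : y.length ≤ x.length := by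
  rcases (sinkOfDAG_iff x y).1 h with ⟨h1, h2⟩ | ⟨-, rfl⟩
  · rw [h2.1, ← h1.1, DAGInstance.decode_encode]
    have := length_le_length_encList encNat (DAGInstance.decode x).succ.outs
    simp [DAGInstance.encode, Circuit.encode, DAGInstance.dim]
    omega
  · simp

/-- This justifies the fixed answer `[]` for void instances of the padded problem. -/
theorem sinkOfDAG_nil : SinkOfDAG [] [] := by
  refine (sinkOfDAG_iff _ _).2 (.inr ⟨fun h => ?_, rfl⟩)
  have h2 : ∀ (α : Type) (e : α → Str) (l : List α), encList e l ≠ [] := by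
    intro α e l
    cases l <;> simp [encList]
  have h3 := h.1
  simp [DAGInstance.encode, Circuit.encode, h2] at h3

/-- A relation on pairs that is decidable in polynomial time. -/
theorem PTP.polyTimeRel {R : Str → Str → Prop} (h : PTP fun t : Str × Str => R t.1 t.2) :
    PolyTimeRel R := by
  obtain ⟨c, p, h⟩ := h
  refine ⟨.seq (.mkPair 0 1 2) (.seq (.mv 1 0 2) c),
    40 * Polynomial.X + 40 + p.comp (2 * Polynomial.X + 1), fun x y => ?_⟩
  have h1 : Runs (.mkPair 0 1 2) (Store.input [x, y, []]) _ _ :=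
    Runs.mkPair_input (by simp) (by simp) (by simp) (by simp) (by simp) (by simp)
  have h2 : Runs (.mv 1 0 2) (Store.input [[], pr x y, []]) _ _ :=
    Runs.mv_input (by simp) (by simp) (by simp) (by simp) (by simp) (by simp)
  have h3 := h (x, y)
  rw [← Store.input_append_replicate [_] 2] at h3
  simp only [List.getD_cons_zero, List.getD_cons_succ, List.set_cons_zero, List.set_cons_succ,
    List.append_nil, length_pr] at h1 h2
  obtain ⟨t, ht, h⟩ := h1.seq (h2.seq h3)
  have h' := h fun _ => []
  rw [show [x, y, []] = [x, y] ++ [[]] from rfl, Store.input_append_nil] at h'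
  refine ⟨truth (R x y), t, ⟨_, h', rfl⟩, ht.trans ?_, ?_⟩
  · have := p.eval_le_eval_nat (show (enc (x, y)).length ≤ 2 * (x.length + y.length) + 1 by
      rw [length_enc_pair]; simp [enc_str]; omega)
    simp [Polynomial.eval_comp]
    omega
  · by_cases hR : R x y <;> simp [truth, hR]

/-! ### FP is contained in PLS -/

namespace Circuit

/-- The gates that compare the tail of the input with `w`.  The wire after the inputs is the
constant `1`, and the wire `|w| + 1 + 3 * k` tells whether the first `k` bits agree. -/
def testGates (w : Str) : List (ℕ × ℕ) :=
  (4 * w.length + 2, 4 * w.length + 2) :: (List.range w.length).flatMap fun i =>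
    [(i + 1, i + 1),
      (w.length + 1 + 3 * i, if w.getD i false = true then i + 1 else w.length + 2 + 3 * i),
      (w.length + 3 + 3 * i, w.length + 3 + 3 * i)]

/-- The first gate reads a wire beyond the last one, hence `0`, and yields the constant `1`. Then
each position of `w` takes three gates: the negated input bit, the NAND of the verdict so far with
the bit or its negation, and the negation of that, which is the new verdict. -/
theorem wires_testGates (w v : Str) (hv : v.length = w.length + 1) (o : List ℕ) :
    ∃ L : Str, (Circuit.mk (testGates w) o).wires v = L ∧ L.length = 4 * w.length + 2 ∧
      L.getD (w.length + 1) false = true ∧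
      L.getD (4 * w.length + 1) false = decide (v.tail = w) := by
  have key : ∀ k ≤ w.length, ∃ L : Str,
      ((4 * w.length + 2, 4 * w.length + 2) :: (List.range k).flatMap fun i =>
        [(i + 1, i + 1),
          (w.length + 1 + 3 * i, if w.getD i false = true then i + 1 else w.length + 2 + 3 * i),
          (w.length + 3 + 3 * i, w.length + 3 + 3 * i)]).foldl
        (fun (w : Str) g => w ++ [!(w.getD g.1 false && w.getD g.2 false)]) v = v ++ true :: L ∧
      L.length = 3 * k ∧
      (v ++ true :: L).getD (w.length + 1 + 3 * k) false =
        decide (∀ i < k, v.getD (i + 1) false = w.getD i false) := by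
    intro k hk
    induction k with
    | zero =>
      refine ⟨[], ?_, rfl, ?_⟩
      · simp [List.getD, List.getElem?_eq_none (show v.length ≤ 4 * w.length + 2 by omega)]
      · simp [List.getD, ← hv]
    | succ k ih =>
      obtain ⟨L, h1, h2, h3⟩ := ih (by omega)
      generalize hW : v ++ true :: L = W at h1 h3
      have hWl : W.length = w.length + 2 + 3 * k := by
        rw [← hW]
        simp
        omega
      have hWv : W.getD (k + 1) false = v.getD (k + 1) false := by
        rw [← hW, List.getD_append _ _ _ _ (by omega)]
      have hlast : ∀ (X : Str) (b : Bool) (n : ℕ), n = X.length → (X ++ [b]).getD n false = b := by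
        rintro X b n rfl
        simp [List.getD]
      have hold : ∀ (X : Str) (b : Bool) (n : ℕ), n < X.length →
          (X ++ [b]).getD n false = X.getD n false := fun X b n hn => List.getD_append _ _ _ _ hn
      set x := v.getD (k + 1) false with hx
      set y := W.getD (w.length + 1 + 3 * k) false with hy
      refine ⟨L ++ [!x, !(y && if w.getD k false = true then x else !x),
        (y && if w.getD k false = true then x else !x)], ?_, by simp [h2]; omega, ?_⟩
      · rw [List.range_succ, List.flatMap_append, ← List.cons_append, List.foldl_append, h1]
        simp only [List.flatMap_cons, List.flatMap_nil, List.append_nil, List.foldl_cons,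
          List.foldl_nil]
        rw [hWv, hold W _ (w.length + 1 + 3 * k) (by omega),
          hlast (_ ++ [_]) _ (w.length + 3 + 3 * k) (by simp; omega), ← hy]
        have : (W ++ [!(x && x)]).getD
            (if w.getD k false = true then k + 1 else w.length + 2 + 3 * k) false =
            if w.getD k false = true then x else !x := by
          split_ifs
          · rw [hold W _ _ (by omega), hWv]
          · rw [hlast W _ _ (by omega), Bool.and_self]
        rw [this, ← hW]
        simp
      · have : v ++ true :: (L ++ [!x, !(y && if w.getD k false = true then x else !x),
            (y && if w.getD k false = true then x else !x)]) =
            (W ++ [!x, !(y && if w.getD k false = true then x else !x)]) ++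
              [(y && if w.getD k false = true then x else !x)] := by
          rw [← hW]
          simp
        rw [this, hlast _ _ _ (by simp; omega), h3]
        simp only [Nat.lt_succ_iff_lt_or_eq, or_imp, forall_and, forall_eq, Bool.decide_and]
        congr 1
        rw [← hx]
        cases w.getD k false <;> cases x <;> simp
  obtain ⟨L, h1, h2, h3⟩ := key w.length le_rfl
  refine ⟨_, h1, by simp [h2]; omega, ?_, ?_⟩
  · simp [List.getD, ← hv]
  · rw [show 4 * w.length + 1 = w.length + 1 + 3 * w.length by omega, h3]
    congr 1
    apply propext
    obtain ⟨b, u, rfl⟩ := List.exists_cons_of_length_eq_add_one hv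
    simp only [List.length_cons, Nat.add_right_cancel_iff] at hv
    simp only [List.getD_cons_succ, List.tail_cons]
    refine ⟨fun h => List.ext_getElem hv fun i hi hi' => ?_, fun h => by simp [h]⟩
    simpa [List.getD, hi, hi'] using h i hi'

/-- The circuit that maps `v` to `E :: w`, where `E` tells whether `w` is the tail of `v`. -/
def testSucc (w : Str) : Circuit where
  gates := testGates w
  outs := (4 * w.length + 1) :: w.map fun b => if b = true then w.length + 1 else 4 * w.length + 2

/-- The circuit that maps `v` to `E :: 0…0`, where `E` tells whether `w` is the tail of `v`. -/
def testVal (w : Str) : Circuit where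
  gates := testGates w
  outs := (4 * w.length + 1) :: List.replicate w.length (4 * w.length + 2)

theorem eval_testSucc (w v : Str) (hv : v.length = w.length + 1) :
    (testSucc w).eval v = decide (v.tail = w) :: w := by
  obtain ⟨L, h1, h2, h3, h4⟩ := wires_testGates w v hv (testSucc w).outs
  rw [eval, testSucc]
  simp only [testSucc] at h1
  rw [h1, List.map_cons, h4, List.map_map]
  congr 1
  conv_rhs => rw [← List.map_id w]
  refine List.map_congr_left fun b _ => ?_
  cases b
  · simp [List.getD, List.getElem?_eq_none h2.le]
  · simpa using h3

theorem eval_testVal (w v : Str) (hv : v.length = w.length + 1) :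
    (testVal w).eval v = decide (v.tail = w) :: List.replicate w.length false := by
  obtain ⟨L, h1, h2, h3, h4⟩ := wires_testGates w v hv (testVal w).outs
  rw [eval, testVal]
  simp only [testVal] at h1
  rw [h1, List.map_cons, h4, List.map_replicate]
  simp [List.getD, List.getElem?_eq_none h2.le]

end Circuit

/-- An instance of Sink-of-DAG whose only solution is `0w`. -/
def DAGInstance.single (w : Str) : DAGInstance := ⟨Circuit.testSucc w, Circuit.testVal w⟩

theorem DAGInstance.dim_single (w : Str) : (single w).dim = w.length + 1 := by
  simp [single, dim, Circuit.testSucc]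

theorem DAGInstance.valid_single (w : Str) : (single w).Valid := by
  refine ⟨by rw [dim_single]; simp [single, Circuit.testVal], ?_⟩
  rw [origin, dim_single, single, Circuit.eval_testSucc _ _ (by simp), List.replicate_succ]
  simp only [List.tail_cons, ne_eq, List.cons.injEq]
  exact fun h => of_decide_eq_false h.1 h.2.symm

/-- If the tail of `v` is not `w`, then `v` has value `0` and its successor `0w` has value `1`. The
successor of `0w` is `1w`, so `0w` is not a fixed point, and `v` satisfies neither alternative of a
solution. -/
theorem DAGInstance.IsSolution.tail_eq {w v : Str} (h : (single w).IsSolution v) : v.tail = w := by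
  obtain ⟨h1, -, h2⟩ := h
  rw [dim_single] at h1
  by_contra hne
  have e1 : (single w).succ.eval v = false :: w := by
    rw [single, Circuit.eval_testSucc _ _ h1]
    simp [hne]
  rw [e1] at h2
  simp only [single] at h2
  rw [Circuit.eval_testSucc _ _ (by simp), Circuit.eval_testVal _ _ (by simp),
    Circuit.eval_testVal _ _ h1, toNum_cons, toNum_cons] at h2
  simp [hne] at h2

theorem PT.testGates : PT Circuit.testGates := by
  unfold Circuit.testGates
  refine PT.listCons (by fun_prop) (PT.flatMap (PT.range (by fun_prop)) (f := fun t : Str × ℕ =>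
    [(t.2 + 1, t.2 + 1), (t.1.length + 1 + 3 * t.2,
      if t.1.getD t.2 false = true then t.2 + 1 else t.1.length + 2 + 3 * t.2),
      (t.1.length + 3 + 3 * t.2, t.1.length + 3 + 3 * t.2)]) ?_)
  have : PTP fun t : Str × ℕ => t.1.getD t.2 false = true :=
    PTP.strGetD (by fun_prop) (by fun_prop)
  fun_prop

theorem PT.single : PT DAGInstance.single := by
  have h := PT.testGates
  refine PT.dagMk (PT.circuitMk h (PT.listCons (by fun_prop) ?_)) (PT.circuitMk h (PT.listCons
    (by fun_prop) ?_))
  · refine (PT.map (l := Str.chars) (f := fun t : Str × Str =>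
      if t.2.head? = some true then t.1.length + 1 else 4 * t.1.length + 2)
      (by fun_prop) (PT.ite (PTP.strHead (by fun_prop)) (by fun_prop) (by fun_prop))).congr
      fun w => ?_
    rw [Str.chars, List.map_map]
    exact List.map_congr_left fun b _ => by simp
  · refine (PT.map (l := Str.chars) (f := fun t : Str × Str => 4 * t.1.length + 2)
      (by fun_prop) (by fun_prop)).congr fun w => ?_
    simp [Str.chars, Function.comp_def]

theorem FP_subset_PLS : FP ⊆ PLS := by
  rintro R ⟨hR, A, hA, h⟩
  refine ⟨hR, fun x => (DAGInstance.single (A x)).encode, List.tail, ?_, ?_, fun x hx y hy => ?_⟩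
  · exact (PT.dagEncode (PT.single.comp hA.pt)).polyTimeFun
  · exact PT.strTail'.polyTimeFun
  · rw [sinkOfDAG_iff, IsDAG, DAGInstance.decode_encode] at hy
    rcases hy with ⟨-, hy⟩ | ⟨hy, -⟩
    · rw [hy.tail_eq]
      exact h x hx
    · exact absurd ⟨rfl, DAGInstance.valid_single _⟩ hy

/-! ### Padding to sparse lengths -/

/-- The least number of the form `2 ^ 2 ^ k` that is at least `n`. -/
def padLen (n : ℕ) : ℕ := (fun u => if u < n then u * u else u)^[n] 2

/-- Repeated squaring starts at `2`. Only numbers below `n` are squared, which gives the upper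
bound, and squaring adds at least `1`, so `n` rounds suffice. -/
theorem padLen_iterate (n i : ℕ) :
    (∃ k, (fun u => if u < n then u * u else u)^[i] 2 = 2 ^ 2 ^ k) ∧
      (fun u => if u < n then u * u else u)^[i] 2 ≤ 2 + n * n ∧
      (n ≤ (fun u => if u < n then u * u else u)^[i] 2 ∨
        i + 2 ≤ (fun u => if u < n then u * u else u)^[i] 2) := by
  induction i with
  | zero => exact ⟨⟨0, by simp⟩, by simp, by simp⟩
  | succ i ih =>
    rw [Function.iterate_succ_apply']
    generalize (fun u => if u < n then u * u else u)^[i] 2 = u at ih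
    obtain ⟨⟨k, hk⟩, h2, h3⟩ := ih
    split_ifs with h
    · refine ⟨⟨k + 1, ?_⟩, ?_, .inr ?_⟩
      · rw [hk, ← pow_add, pow_succ, mul_two]
      · have := Nat.mul_le_mul h.le h.le
        omega
      · have := Nat.mul_le_mul_right u (show 2 ≤ u by omega)
        omega
    · exact ⟨⟨k, hk⟩, h2, .inl (by omega)⟩

theorem exists_padLen_eq (n : ℕ) : ∃ k, padLen n = 2 ^ 2 ^ k := (padLen_iterate n n).1

theorem le_padLen (n : ℕ) : n ≤ padLen n := by
  rcases (padLen_iterate n n).2.2 with h | h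
  · exact h
  · exact le_trans (by omega) h

theorem padLen_pow (k : ℕ) : padLen (2 ^ 2 ^ k) = 2 ^ 2 ^ k := by
  refine le_antisymm ?_ (le_padLen _)
  suffices ∀ i, ∃ j ≤ k, (fun u => if u < 2 ^ 2 ^ k then u * u else u)^[i] 2 = 2 ^ 2 ^ j by
    obtain ⟨j, hj, h⟩ := this (2 ^ 2 ^ k)
    rw [padLen, h]
    exact Nat.pow_le_pow_right (by omega) (Nat.pow_le_pow_right (by omega) hj)
  intro i
  induction i with
  | zero => exact ⟨0, by omega, by simp⟩
  | succ i ih =>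
    obtain ⟨j, hj, h⟩ := ih
    rw [Function.iterate_succ_apply', h]
    split_ifs with hlt
    · refine ⟨j + 1, ?_, ?_⟩
      · rcases hj.lt_or_eq with h | h
        · exact h
        · rw [h] at hlt
          exact absurd hlt (lt_irrefl _)
      · rw [← pow_add, pow_succ, mul_two]
    · exact ⟨j, hj, rfl⟩

theorem padLen_padLen (n : ℕ) : padLen (padLen n) = padLen n := by
  obtain ⟨k, hk⟩ := exists_padLen_eq n
  rw [hk, padLen_pow]

/-- The gap on which the argument rests: the square of `2 ^ 2 ^ j` is `2 ^ 2 ^ (j + 1)`, the next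
admissible length. -/
theorem mul_self_le_of_padLen {a b : ℕ} (ha : padLen a = a) (hb : padLen b = b) (hab : a < b) :
    a * a ≤ b := by
  obtain ⟨j, hj⟩ := exists_padLen_eq a
  obtain ⟨k, hk⟩ := exists_padLen_eq b
  rw [ha] at hj
  rw [hb] at hk
  subst hj hk
  have hjk : j < k := by
    by_contra h
    exact absurd (Nat.pow_le_pow_right (n := 2) (by omega)
      (Nat.pow_le_pow_right (n := 2) (by omega) (not_lt.1 h))) (not_le.2 hab)
  rw [← pow_add, ← mul_two, ← pow_succ]
  exact Nat.pow_le_pow_right (by omega) (Nat.pow_le_pow_right (by omega) hjk)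

theorem two_le_of_padLen {a : ℕ} (ha : padLen a = a) : 2 ≤ a := by
  obtain ⟨j, hj⟩ := exists_padLen_eq a
  rw [ha] at hj
  rw [hj]
  exact Nat.le_self_pow (by positivity) 2

@[fun_prop]
theorem PT.padLen {α : Type} [Enc α] {n : α → ℕ} (hn : PT n) : PT fun a => padLen (n a) := by
  refine PT.comp (g := _root_.padLen) ?_ hn
  exact (PT.iterate (n := fun n : ℕ => n) (init := fun _ => 2)
    (step := fun t : ℕ × ℕ => if t.2 < t.1 then t.2 * t.2 else t.2) (by fun_prop) (by fun_prop)
    (by fun_prop) ⟨2 + Polynomial.X * Polynomial.X, fun n i _ => by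
      simpa [length_enc_nat] using (padLen_iterate n i).2.1⟩).congr fun n => by
        rw [length_enc_nat, _root_.padLen]

/-- Pad a string to a length of the form `2 ^ 2 ^ k`. -/
def pad (x : Str) : Str :=
  List.replicate (padLen (x.length + 1) - (x.length + 1)) false ++ true :: x

/-- Remove the padding; strings whose length does not have the form `2 ^ 2 ^ k` are void. -/
def unpad (y : Str) : Str :=
  if padLen y.length = y.length then (y.dropWhile (· == false)).tail else []

theorem unpad_pad (x : Str) : unpad (pad x) = x := by
  have : (pad x).length = padLen (x.length + 1) := by
    have := le_padLen (x.length + 1)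
    simp [pad]
    omega
  rw [unpad, this, if_pos (padLen_padLen _), pad]
  generalize padLen (x.length + 1) - (x.length + 1) = k
  cases k <;> simp [List.replicate_succ]

theorem length_unpad_le (y : Str) : (unpad y).length ≤ y.length := by
  rw [unpad]
  split_ifs
  · have := (List.dropWhile_suffix (l := y) (· == false)).length_le
    rw [List.length_tail]
    omega
  · simp

theorem padLen_of_unpad_ne {y : Str} (h : unpad y ≠ []) : padLen y.length = y.length := by
  by_contra hne
  exact h (if_neg hne)

theorem PT.pad : PT pad := by
  unfold _root_.pad
  fun_prop

theorem PT.unpad : PT unpad := by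
  unfold _root_.unpad
  exact PT.ite (PTP.natEq (by fun_prop) (by fun_prop))
    (PT.strTail (PT.strDropWhile false (by fun_prop))) (by fun_prop)

/-- Sink-of-DAG with padded instances. -/
def PaddedSink : SearchProblem := fun x y => SinkOfDAG (unpad x) y

theorem paddedSink_mem_TFNP : PaddedSink ∈ TFNP := by
  refine ⟨fun x => sinkOfDAG_total _, ⟨Polynomial.X, fun x y h => ?_⟩, ?_⟩
  · simpa using (length_le_of_sinkOfDAG h).trans (length_unpad_le x)
  · exact PTP.polyTimeRel (PTP.sinkOfDAG.comp (f := fun t : Str × Str => (unpad t.1, t.2))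
      ((PT.unpad.comp PT.fst).prodMk PT.snd))

/-- Removing the padding reduces to Sink-of-DAG, and adding it reduces back. Solutions are unchanged
in both directions. -/
theorem paddedSink_plsComplete : PLSComplete PaddedSink := by
  refine ⟨⟨paddedSink_mem_TFNP, unpad, fun y => y, PT.unpad.polyTimeFun, PT.id.polyTimeFun,
    fun x _ y h => h⟩, ?_⟩
  rintro Q ⟨-, f, g, hf, hg, h⟩
  refine ⟨fun x => pad (f x), g, (PT.pad.comp hf.pt).polyTimeFun, hg, fun x hx y hy => h x hx y ?_⟩
  rwa [PaddedSink, unpad_pad] at hy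

/-! ### An interpreter for recursive oracle programs -/

/-- The encoding of programs. -/
def Cmd.encode : Cmd → Str
  | skip => [false]
  | push b r => true :: false :: pr [b] (enc r)
  | pop r => true :: true :: false :: enc r
  | branch r c d e =>
    true :: true :: true :: false :: pr (enc r) (pr c.encode (pr d.encode e.encode))
  | seq c d => true :: true :: true :: true :: false :: pr c.encode d.encode
  | loop r c => true :: true :: true :: true :: true :: false :: pr (enc r) c.encode
  | query s d => true :: true :: true :: true :: true :: true :: pr (enc s) (enc d)

instance : Enc Cmd := ⟨Cmd.encode⟩

/-- The head symbol and the arguments of a program. -/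
def Cmd.unfold : Cmd → Unit ⊕ (Str × ℕ) ⊕ ℕ ⊕ (ℕ × Cmd × Cmd × Cmd) ⊕ (Cmd × Cmd) ⊕
    (ℕ × Cmd) ⊕ (ℕ × ℕ)
  | skip => .inl ()
  | push b r => .inr (.inl ([b], r))
  | pop r => .inr (.inr (.inl r))
  | branch r c d e => .inr (.inr (.inr (.inl (r, c, d, e))))
  | seq c d => .inr (.inr (.inr (.inr (.inl (c, d)))))
  | loop r c => .inr (.inr (.inr (.inr (.inr (.inl (r, c))))))
  | query s d => .inr (.inr (.inr (.inr (.inr (.inr (s, d))))))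

/-- The encoding of programs is designed to agree with that of the nested sum, so unfolding does
nothing to the string. -/
theorem PT.cmdUnfold : PT Cmd.unfold := PT.of_enc_eq fun c => by cases c <;> rfl

theorem PT.cmdCases {α δ : Type} [Enc α] [Enc δ] {c : α → Cmd} {f₀ : α → δ} {f₁ : α × Str × ℕ → δ}
    {f₂ : α × ℕ → δ} {f₃ : α × ℕ × Cmd × Cmd × Cmd → δ} {f₄ : α × Cmd × Cmd → δ}
    {f₅ : α × ℕ × Cmd → δ} {f₆ : α × ℕ × ℕ → δ} (hc : PT c) (h₀ : PT f₀) (h₁ : PT f₁) (h₂ : PT f₂)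
    (h₃ : PT f₃) (h₄ : PT f₄) (h₅ : PT f₅) (h₆ : PT f₆) : PT fun a => match c a with
      | .skip => f₀ a
      | .push b r => f₁ (a, [b], r)
      | .pop r => f₂ (a, r)
      | .branch r c d e => f₃ (a, r, c, d, e)
      | .seq c d => f₄ (a, c, d)
      | .loop r c => f₅ (a, r, c)
      | .query s d => f₆ (a, s, d) := by
  have e6 := sumCases (α := α × _) (s := fun t => t.2) (f := fun t => f₅ (t.1.1, t.2))
    (g := fun t => f₆ (t.1.1, t.2)) (by fun_prop) (by fun_prop) (by fun_prop)
  have e5 := sumCases (α := α × _) (s := fun t => t.2) (f := fun t => f₄ (t.1.1, t.2))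
    (PT.snd) (by fun_prop) (e6.comp (f := fun t => (t.1.1, t.2)) (by fun_prop))
  have e4 := sumCases (α := α × _) (s := fun t => t.2) (f := fun t => f₃ (t.1.1, t.2))
    (PT.snd) (by fun_prop) (e5.comp (f := fun t => (t.1.1, t.2)) (by fun_prop))
  have e3 := sumCases (α := α × _) (s := fun t => t.2) (f := fun t => f₂ (t.1.1, t.2))
    (PT.snd) (by fun_prop) (e4.comp (f := fun t => (t.1.1, t.2)) (by fun_prop))
  have e2 := sumCases (α := α × _) (s := fun t => t.2) (f := fun t => f₁ (t.1.1, t.2))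
    (PT.snd) (by fun_prop) (e3.comp (f := fun t => (t.1.1, t.2)) (by fun_prop))
  have e1 := sumCases (f := fun t => f₀ t.1) (cmdUnfold.comp hc) (by fun_prop) e2
  refine e1.congr fun a => ?_
  cases c a <;> rfl

/-- The state of the interpreter: the remaining program, the stacks, and the suspended calls, each
with the stack that waits for the answer. -/
abbrev RecState := List Cmd × List Str × List (ℕ × List Cmd × List Str)

namespace RecState

/-- The call of the program `c` on the input `q`; void inputs are answered at once. -/
def start (c : Cmd) (q : Str) (r : List (ℕ × List Cmd × List Str)) : RecState :=
  if unpad q = [] then ([], [[]], r) else ([c], q :: List.replicate c.bound [], r)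

/-- Execute one instruction. -/
def exec (c : Cmd) (d : Cmd) (k : List Cmd) (l : List Str) (r : List (ℕ × List Cmd × List Str)) :
    RecState :=
  match d with
  | .skip => (k, l, r)
  | .push b i => (k, l.set i ([b] ++ l.getD i []), r)
  | .pop i => (k, l.set i (l.getD i []).tail, r)
  | .branch i d₀ d₁ d₂ => (match l.getD i [] with
    | [] => d₀ :: k
    | false :: _ => d₁ :: k
    | true :: _ => d₂ :: k, l, r)
  | .seq d e => (d :: e :: k, l, r)
  | .loop i d => (if l.getD i [] = [] then k else d :: .loop i d :: k, l, r)
  | .query s d => start c (l.getD s []) ((d, k, l) :: r)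

/-- One step of the interpreter. -/
def step (c : Cmd) (t : RecState) : RecState :=
  match t.1 with
  | [] => (match t.2.2 with
    -- The finished state is a fixed point, so surplus steps of the interpreter do no harm.
    | [] => t
    | (d, k, l) :: r => (k, l.set d (t.2.1.getD 0 []), r))
  | d :: k => exec c d k t.2.1 t.2.2

end RecState

namespace PT

open RecState

variable {α : Type} [Enc α]

theorem recStart (c : Cmd) {q : α → Str} {r : α → List (ℕ × List Cmd × List Str)} (hq : PT q)
    (hr : PT r) : PT fun a => start c (q a) (r a) := by
  unfold start
  exact PT.ite (PTP.strEqNil (unpad.comp hq)) (by fun_prop) (by fun_prop)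

theorem recExec (c : Cmd) : PT fun t : Cmd × RecState => exec c t.1 t.2.1 t.2.2.1 t.2.2.2 := by
  have hg {β : Type} [Enc β] {l : β → List Str} {i : β → ℕ} (hl : PT l) (hi : PT i) :
      PT fun b => (l b).getD (i b) [] := getD hl hi (const [])
  unfold exec
  refine cmdCases (α := Cmd × RecState) (c := fun t => t.1) (f₀ := fun t => t.2)
    (f₁ := fun t => (t.1.2.1, t.1.2.2.1.set t.2.2 (t.2.1 ++ t.1.2.2.1.getD t.2.2 []), t.1.2.2.2))
    (f₂ := fun t => (t.1.2.1, t.1.2.2.1.set t.2 (t.1.2.2.1.getD t.2 []).tail, t.1.2.2.2))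
    (f₃ := fun t => (match t.1.2.2.1.getD t.2.1 [] with
      | [] => t.2.2.1 :: t.1.2.1
      | false :: _ => t.2.2.2.1 :: t.1.2.1
      | true :: _ => t.2.2.2.2 :: t.1.2.1, t.1.2.2.1, t.1.2.2.2))
    (f₄ := fun t => (t.2.1 :: t.2.2 :: t.1.2.1, t.1.2.2.1, t.1.2.2.2))
    (f₅ := fun t => (if t.1.2.2.1.getD t.2.1 [] = [] then t.1.2.1 else
      t.2.2 :: .loop t.2.1 t.2.2 :: t.1.2.1, t.1.2.2.1, t.1.2.2.2))
    (f₆ := fun t => start c (t.1.2.2.1.getD t.2.1 []) ((t.2.2, t.1.2.1, t.1.2.2.1) :: t.1.2.2.2))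
    (by fun_prop) (by fun_prop) ?_ ?_ ?_ (by fun_prop) ?_ ?_
  · exact prodMk (by fun_prop) (prodMk (set (by fun_prop) (by fun_prop)
      (strAppend (by fun_prop) (hg (by fun_prop) (by fun_prop)))) (by fun_prop))
  · exact prodMk (by fun_prop) (prodMk (set (by fun_prop) (by fun_prop)
      (strTail (hg (by fun_prop) (by fun_prop)))) (by fun_prop))
  · refine prodMk ?_ (by fun_prop)
    exact strCases (s := fun t : (Cmd × RecState) × ℕ × Cmd × Cmd × Cmd =>
      t.1.2.2.1.getD t.2.1 []) (f := fun t => t.2.2.1 :: t.1.2.1)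
      (g := fun t : ((Cmd × RecState) × ℕ × Cmd × Cmd × Cmd) × Str => t.1.2.2.2.1 :: t.1.1.2.1)
      (h := fun t : ((Cmd × RecState) × ℕ × Cmd × Cmd × Cmd) × Str => t.1.2.2.2.2 :: t.1.1.2.1)
      (hg (by fun_prop) (by fun_prop)) (by fun_prop) (by fun_prop) (by fun_prop)
  · refine prodMk (PT.ite (PTP.strEqNil (hg (by fun_prop) (by fun_prop))) (by fun_prop) ?_)
      (by fun_prop)
    refine listCons (by fun_prop) (listCons ?_ (by fun_prop))
    have : PT fun t : ℕ × Cmd => Cmd.loop t.1 t.2 :=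
      (strCons true (strCons true (strCons true (strCons true (strCons true
        (strCons false (encode (α := ℕ × Cmd)))))))).enc_congr fun _ => rfl
    exact this.comp (f := fun t : (Cmd × RecState) × ℕ × Cmd => t.2) (by fun_prop)
  · exact recStart c (q := fun t : (Cmd × RecState) × ℕ × ℕ => t.1.2.2.1.getD t.2.1 [])
      (hg (by fun_prop) (by fun_prop)) (by fun_prop)

theorem recStep (c : Cmd) : PT (step c) := by
  have h : PT fun t : RecState => (match t.2.2 with
      | [] => t
      | (d, k, l) :: r => (k, l.set d (t.2.1.getD 0 []), r) : RecState) :=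
    (listCases (f := fun t : RecState => t) (l := fun t => t.2.2)
      (g := fun t : RecState × (ℕ × List Cmd × List Str) × List (ℕ × List Cmd × List Str) =>
        (t.2.1.2.1, t.2.1.2.2.set t.2.1.1 (t.1.2.1.getD 0 []), t.2.2)) (by fun_prop) (by fun_prop)
      (prodMk (by fun_prop) (prodMk (set (by fun_prop) (by fun_prop)
        (getD (by fun_prop) (by fun_prop) (by fun_prop))) (by fun_prop)))).congr fun t => by
          rcases t with ⟨k, l, _ | ⟨f, r⟩⟩ <;> rfl
  exact (listCases (l := fun t : RecState => t.1)
    (g := fun t : RecState × Cmd × List Cmd => exec c t.2.1 t.2.2 t.1.2.1 t.1.2.2) (by fun_prop)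
    h ((recExec c).comp (f := fun t : RecState × Cmd × List Cmd =>
      (t.2.1, t.2.2, t.1.2.1, t.1.2.2)) (by fun_prop))).congr fun t => by
        rcases t with ⟨_ | ⟨d, k⟩, l, r⟩ <;> rfl

end PT

/-! ### The work of the interpreter -/

namespace RecState

/-- A measure for the size of a state. -/
def size (t : RecState) : ℕ :=
  (enc t.1).length + (enc t.2.1).length +
    (t.2.2.map fun f => f.1 + 1 + (enc f.2.1).length + (enc f.2.2).length).sum

/-- Programs and stacks weigh the same in `size` whether they are active or suspended, so calls and
returns can be accounted for additively. In the encoding the weights depend on the place; with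
`length_enc_le`, the two measures agree up to constants. -/
theorem size_le (t : RecState) : size t ≤ (enc t).length := by
  obtain ⟨k, l, r⟩ := t
  have : (r.map fun f => f.1 + 1 + (enc f.2.1).length + (enc f.2.2).length).sum ≤
      (enc r).length := by
    rw [length_enc_list]
    refine List.sum_le_sum fun f _ => ?_
    obtain ⟨d, k, l⟩ := f
    simp only [length_enc_pair, length_enc_nat]
    omega
  rw [length_enc_pair, length_enc_pair]
  simp only [size]
  omega

theorem length_enc_le (t : RecState) : (enc t).length ≤ 11 * size t + 2 := by
  obtain ⟨k, l, r⟩ := t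
  have : (enc r).length ≤
      11 * (r.map fun f => f.1 + 1 + (enc f.2.1).length + (enc f.2.2).length).sum := by
    rw [length_enc_list, ← List.sum_map_mul_left]
    refine List.sum_le_sum fun f _ => ?_
    obtain ⟨d, k, l⟩ := f
    simp only [length_enc_pair, length_enc_nat]
    omega
  rw [length_enc_pair, length_enc_pair]
  simp only [size]
  omega

/-- The interpreter for `c` leads from `t` to `t'`; neither the number of steps nor the growth of
the state exceeds `w`. -/
def Reach (c : Cmd) (t t' : RecState) (w : ℕ) : Prop :=
  ∃ n ≤ w, (step c)^[n] t = t' ∧ ∀ i ≤ n, size ((step c)^[i] t) ≤ size t + w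

namespace Reach

variable {c : Cmd} {t t' t'' : RecState} {w w' : ℕ}

theorem mono (h : Reach c t t' w) (hw : w ≤ w') : Reach c t t' w' :=
  let ⟨n, hn, h1, h2⟩ := h
  ⟨n, hn.trans hw, h1, fun i hi => (h2 i hi).trans (by omega)⟩

theorem refl (c : Cmd) (t : RecState) : Reach c t t 0 :=
  ⟨0, le_rfl, rfl, fun i hi => by rw [Nat.le_zero.1 hi]; simp⟩

/-- One number bounds both time and growth, so sequential composition adds the bounds. -/
theorem trans (h : Reach c t t' w) (h' : Reach c t' t'' w') : Reach c t t'' (w + w') := by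
  obtain ⟨n, hn, h1, h2⟩ := h
  obtain ⟨n', hn', h3, h4⟩ := h'
  refine ⟨n' + n, by omega, by rw [Function.iterate_add_apply, h1, h3], fun i hi => ?_⟩
  rcases le_total i n with h | h
  · have := h2 i h
    omega
  · obtain ⟨j, rfl⟩ := Nat.exists_eq_add_of_le' h
    rw [Function.iterate_add_apply, h1]
    have := h4 j (by omega)
    have := h2 n le_rfl
    rw [h1] at this
    omega

theorem single (h : step c t = t') (hw : size t' ≤ size t + w) (hw' : 1 ≤ w) : Reach c t t' w := by
  refine ⟨1, hw', h, fun i hi => ?_⟩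
  interval_cases i
  · simp
  · simpa [h] using hw

end Reach

end RecState

theorem length_enc_set (l : List Str) (i : ℕ) (v : Str) :
    (enc (l.set i v)).length + 2 * (l.getD i []).length ≤ (enc l).length + 2 * v.length := by
  induction l generalizing i with
  | nil => simp
  | cons a l ih =>
    cases i with
    | zero => simp [length_enc_cons, enc_str]; omega
    | succ i =>
      have := ih i
      simp [length_enc_cons] at this ⊢
      omega

theorem length_getD_le (l : List Str) (i : ℕ) : 2 * (l.getD i []).length ≤ (enc l).length := by
  have := length_enc_set l i []
  simp at this ⊢
  omega

theorem length_enc_replicate_nil (m : ℕ) :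
    (enc (List.replicate m ([] : Str))).length = m := by
  rw [length_enc_list]
  simp [enc_str]

/-! ### Simulation of an oracle run by the interpreter -/

section Simulation

open RecState

/-- Every call on `q` returns the answer `O q`, with work at most `w`. -/
def Answers (c : Cmd) (O : Str → Str) (q : Str) (w : ℕ) : Prop :=
  ∀ r, ∃ l, Reach c (start c q r) ([], l, r) w ∧ l.getD 0 [] = O q

theorem Answers.mono {c : Cmd} {O : Str → Str} {q : Str} {w w' : ℕ} (h : Answers c O q w)
    (hw : w ≤ w') : Answers c O q w' := fun r =>
  let ⟨l, h1, h2⟩ := h r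
  ⟨l, h1.mono hw, h2⟩

/-- A bound for the work of one instruction. -/
def stepCost (c : Cmd) : ℕ := 2 * (enc c).length + c.bound + 6

theorem size_start_le (c : Cmd) (q : Str) (r : List (ℕ × List Cmd × List Str)) :
    size (start c q r) ≤ 2 * (enc c).length + c.bound + 2 + 2 * q.length +
      (r.map fun f => f.1 + 1 + (enc f.2.1).length + (enc f.2.2).length).sum := by
  rw [start]
  split_ifs
  · simp only [size, length_enc_cons, enc_nil, enc_str, List.length_nil]
    omega
  · simp only [size, length_enc_cons, enc_nil, enc_str, List.length_nil, length_enc_replicate_nil]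
    omega

/-- Induction on the run. Each unit of its time pays for one instruction of the interpreter and, if
need be, for one recursive answer of work `w`. The list keeps `c₀.bound + 1` entries, so every stack
mentioned is present; `hc` bounds the copy of a body that a loop makes. -/
theorem Exec.reach {O : Str → Str} {c₀ c : Cmd} {σ σ' : Store} {t : ℕ} {qs : List Str} {w : ℕ}
    (h : Exec O c σ σ' t qs) (hc : (enc c).length ≤ (enc c₀).length) (hb : c.bound ≤ c₀.bound)
    (hq : ∀ q ∈ qs, Answers c₀ O q w) (l : List Str) (hl : l.length = c₀.bound + 1)
    (hσ : σ = Store.input l) : ∃ l', l'.length = c₀.bound + 1 ∧ σ' = Store.input l' ∧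
      ∀ k r, Reach c₀ (c :: k, l, r) (k, l', r) (t * (stepCost c₀ + w)) := by
  have hget : ∀ r, σ r = l.getD r [] := fun r => by rw [hσ]; rfl
  have h1 : 6 ≤ stepCost c₀ := by rw [stepCost]; omega
  induction h generalizing l with
  | skip σ =>
    refine ⟨l, hl, hσ, fun k r => Reach.single rfl ?_ (by omega)⟩
    simp only [size, length_enc_cons]
    omega
  | push b i σ =>
    have hi : i < l.length := by simp only [Cmd.bound] at hb; omega
    refine ⟨l.set i (b :: σ i), by simpa using hl, by rw [hσ, Store.update_input hi], fun k r =>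
      Reach.single (by rw [hget]; rfl) ?_ (by omega)⟩
    have := length_enc_set l i (b :: σ i)
    rw [List.length_cons, hget] at this
    simp only [size, length_enc_cons, hget]
    omega
  | pop i σ =>
    have hi : i < l.length := by simp only [Cmd.bound] at hb; omega
    refine ⟨l.set i (σ i).tail, by simpa using hl, by rw [hσ, Store.update_input hi], fun k r =>
      Reach.single (by rw [hget]; rfl) ?_ (by omega)⟩
    have := length_enc_set l i (σ i).tail
    rw [List.length_tail, hget] at this
    simp only [size, length_enc_cons, hget]
    omega
  | @branch_empty i c₁ c₂ c₃ σ σ' t qs hi _ ih =>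
    have e : (enc (Cmd.branch i c₁ c₂ c₃)).length = 4 + (2 * i + 1 + (2 * (enc c₁).length + 1 +
        (2 * (enc c₂).length + 1 + (enc c₃).length))) := by
      change (_ :: _ :: _ :: _ :: pr (enc i) (pr (enc c₁) (pr (enc c₂) (enc c₃)))).length = _
      simp only [List.length_cons, length_pr, length_enc_nat]
      omega
    obtain ⟨l', h2, h3, h4⟩ := ih (by omega) (by simp only [Cmd.bound] at hb; omega) hq l hl hσ hget
    refine ⟨l', h2, h3, fun k r => ((Reach.single (t' := (c₁ :: k, l, r)) (w := 1) ?_ ?_ le_rfl).trans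
      (h4 k r)).mono (by rw [Nat.succ_mul]; omega)⟩
    · simp only [step, exec, ← hget, hi]
    · simp only [size, length_enc_cons]
      omega
  | @branch_zero i c₁ c₂ c₃ σ σ' t qs v hi _ ih =>
    have e : (enc (Cmd.branch i c₁ c₂ c₃)).length = 4 + (2 * i + 1 + (2 * (enc c₁).length + 1 +
        (2 * (enc c₂).length + 1 + (enc c₃).length))) := by
      change (_ :: _ :: _ :: _ :: pr (enc i) (pr (enc c₁) (pr (enc c₂) (enc c₃)))).length = _
      simp only [List.length_cons, length_pr, length_enc_nat]
      omega
    obtain ⟨l', h2, h3, h4⟩ := ih (by omega) (by simp only [Cmd.bound] at hb; omega) hq l hl hσ hget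
    refine ⟨l', h2, h3, fun k r => ((Reach.single (t' := (c₂ :: k, l, r)) (w := 1) ?_ ?_ le_rfl).trans
      (h4 k r)).mono (by rw [Nat.succ_mul]; omega)⟩
    · simp only [step, exec, ← hget, hi]
    · simp only [size, length_enc_cons]
      omega
  | @branch_one i c₁ c₂ c₃ σ σ' t qs v hi _ ih =>
    have e : (enc (Cmd.branch i c₁ c₂ c₃)).length = 4 + (2 * i + 1 + (2 * (enc c₁).length + 1 +
        (2 * (enc c₂).length + 1 + (enc c₃).length))) := by
      change (_ :: _ :: _ :: _ :: pr (enc i) (pr (enc c₁) (pr (enc c₂) (enc c₃)))).length = _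
      simp only [List.length_cons, length_pr, length_enc_nat]
      omega
    obtain ⟨l', h2, h3, h4⟩ := ih (by omega) (by simp only [Cmd.bound] at hb; omega) hq l hl hσ hget
    refine ⟨l', h2, h3, fun k r => ((Reach.single (t' := (c₃ :: k, l, r)) (w := 1) ?_ ?_ le_rfl).trans
      (h4 k r)).mono (by rw [Nat.succ_mul]; omega)⟩
    · simp only [step, exec, ← hget, hi]
    · simp only [size, length_enc_cons]
      omega
  | @seq c d σ σ' σ'' t t' qs qs' _ _ ih ih' =>
    have e : (enc (Cmd.seq c d)).length = 5 + (2 * (enc c).length + 1 + (enc d).length) := by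
      change (_ :: _ :: _ :: _ :: _ :: pr (enc c) (enc d)).length = _
      simp only [List.length_cons, length_pr]
      omega
    obtain ⟨l', h2, h3, h4⟩ := ih (by omega) (by simp only [Cmd.bound] at hb; omega)
      (fun q hq' => hq q (by simp [hq'])) l hl hσ hget
    obtain ⟨l'', h5, h6, h7⟩ := ih' (by omega) (by simp only [Cmd.bound] at hb; omega)
      (fun q hq' => hq q (by simp [hq'])) l' h2 h3 (fun r => by rw [h3]; rfl)
    refine ⟨l'', h5, h6, fun k r => ((Reach.single (t' := (c :: d :: k, l, r)) (w := 1) rfl ?_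
      le_rfl).trans ((h4 _ r).trans (h7 k r))).mono (by rw [Nat.succ_mul, Nat.add_mul]; omega)⟩
    simp only [size, length_enc_cons]
    omega
  | @loop_done i c σ hi =>
    refine ⟨l, hl, hσ, fun k r => Reach.single ?_ ?_ (by omega)⟩
    · simp only [step, exec, ← hget, hi, if_true]
    · simp only [size, length_enc_cons]
      omega
  | @loop_step i c σ σ' σ'' t t' qs qs' hi _ _ ih ih' =>
    have e : (enc (Cmd.loop i c)).length = 6 + (2 * i + 1 + (enc c).length) := by
      change (_ :: _ :: _ :: _ :: _ :: _ :: pr (enc i) (enc c)).length = _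
      simp only [List.length_cons, length_pr, length_enc_nat]
      omega
    obtain ⟨l', h2, h3, h4⟩ := ih (by omega) (by simp only [Cmd.bound] at hb; omega)
      (fun q hq' => hq q (by simp [hq'])) l hl hσ hget
    obtain ⟨l'', h5, h6, h7⟩ := ih' hc hb
      (fun q hq' => hq q (by simp [hq'])) l' h2 h3 (fun r => by rw [h3]; rfl)
    -- Unlike `branch` and `seq`, entering a loop enlarges the state, by a copy of the body.
    refine ⟨l'', h5, h6, fun k r => ((Reach.single (t' := (c :: .loop i c :: k, l, r))
      (w := stepCost c₀) ?_ ?_ (by omega)).trans ((h4 _ r).trans (h7 k r))).mono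
      (by rw [Nat.succ_mul, Nat.add_mul]; omega)⟩
    · simp only [step, exec, ← hget, hi, if_false]
    · simp only [size, length_enc_cons, stepCost]
      omega
  | query s d σ =>
    have e : (enc (Cmd.query s d)).length = 6 + (2 * s + 1 + d) := by
      change (_ :: _ :: _ :: _ :: _ :: _ :: pr (enc s) (enc d)).length = _
      simp only [List.length_cons, length_pr, length_enc_nat]
      omega
    have hd : d < l.length := by simp only [Cmd.bound] at hb; omega
    refine ⟨l.set d (O (σ s)), by simpa using hl, by rw [hσ, Store.update_input hd], fun k r => ?_⟩
    obtain ⟨l', h2, h3⟩ := hq (σ s) (by simp) ((d, k, l) :: r)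
    -- The query string enters the encoded stacks of the new call with weight `2`. One unit of
    -- `stepCost c₀` is saved for the return.
    have h4 : Reach c₀ (Cmd.query s d :: k, l, r) (start c₀ (σ s) ((d, k, l) :: r))
        (stepCost c₀ - 1 + 2 * (σ s).length) := by
      refine Reach.single (by rw [hget]; rfl) ?_ (by omega)
      have := size_start_le c₀ (σ s) ((d, k, l) :: r)
      simp only [List.map_cons, List.sum_cons] at this
      simp only [size, length_enc_cons, stepCost] at this ⊢
      omega
    -- The return does not enlarge the state: the answer is already counted, with the same weight
    -- `2`, in the stacks of the call that ends.
    have h5 : Reach c₀ ([], l', (d, k, l) :: r) (k, l.set d (O (σ s)), r) 1 := by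
      refine Reach.single (by rw [← h3]; rfl) ?_ le_rfl
      have h6 := length_enc_set l d (O (σ s))
      have h7 := length_getD_le l' 0
      rw [h3] at h7
      simp only [size, List.map_cons, List.sum_cons, enc_nil, List.length_nil]
      omega
    refine (h4.trans (h2.trans h5)).mono ?_
    -- The charge for the length of the query pays for copying it into the new call.
    have := Nat.mul_le_mul_left (σ s).length (show 2 ≤ stepCost c₀ + w by omega)
    rw [Nat.add_mul]
    omega

end Simulation

/-! ### The recursion takes polynomial time -/

/-- For `n ≥ 2` factors are absorbed into the exponent, by `c ≤ 2 ^ c ≤ n ^ c`. A pure power is what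
makes the recurrence close up. -/
theorem Polynomial.exists_eval_le_pow (p : Polynomial ℕ) : ∃ D, ∀ n, 2 ≤ n → p.eval n ≤ n ^ D := by
  induction p using Polynomial.induction_on' with
  | add p q hp hq =>
    obtain ⟨a, ha⟩ := hp
    obtain ⟨b, hb⟩ := hq
    refine ⟨a + b + 1, fun n hn => ?_⟩
    have h1 := (ha n hn).trans (Nat.pow_le_pow_right (by omega) (Nat.le_add_right a b))
    have h2 := (hb n hn).trans (Nat.pow_le_pow_right (by omega) (Nat.le_add_left b a))
    have h3 := Nat.mul_le_mul_left (n ^ (a + b)) hn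
    rw [Polynomial.eval_add, pow_succ]
    omega
  | monomial k c =>
    refine ⟨c + k, fun n hn => ?_⟩
    rw [Polynomial.eval_monomial, pow_add]
    exact Nat.mul_le_mul_right _ ((Nat.lt_two_pow_self).le.trans (Nat.pow_le_pow_left hn c))

/-- An oracle for the padded problem that answers void queries by the empty string, and the others
by the program `c`, which may query the oracle on shorter strings. -/
theorem exists_selfOracle {c : Cmd} {p : Polynomial ℕ}
    (h : ∀ O : Str → Str, (∀ q, PaddedSink.completion q (O q)) →
      ∀ x : Str, ∃ (σ : Store) (t : ℕ) (qs : List Str),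
        Exec O c (Store.input [x]) σ t qs ∧ t ≤ p.eval x.length ∧
          (x ∈ PaddedSink.dom → PaddedSink x (σ 0) ∧
            ∀ q ∈ qs, q ∈ PaddedSink.dom ∧ q.length < x.length)) :
    ∃ O : Str → Str, ∀ x, PaddedSink x (O x) ∧ (unpad x = [] → O x = []) ∧
      (unpad x ≠ [] → ∃ (σ : Store) (t : ℕ) (qs : List Str),
        Exec O c (Store.input [x]) σ t qs ∧ t ≤ p.eval x.length ∧ σ 0 = O x ∧
          ∀ q ∈ qs, q.length < x.length) := by
  have htot : ∀ x, x ∈ PaddedSink.dom := fun x => sinkOfDAG_total _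
  let Good : (Str → Str) → Str → Prop := fun O x =>
    PaddedSink x (O x) ∧ (unpad x = [] → O x = []) ∧
      (unpad x ≠ [] → ∃ (σ : Store) (t : ℕ) (qs : List Str),
        Exec O c (Store.input [x]) σ t qs ∧ t ≤ p.eval x.length ∧ σ 0 = O x ∧
          ∀ q ∈ qs, q.length < x.length)
  -- A valid oracle can be improved on the strings of length `n`.
  have hstep : ∀ (n : ℕ) (O : Str → Str), (∀ x, PaddedSink x (O x)) → ∃ O' : Str → Str,
      (∀ x, PaddedSink x (O' x)) ∧ (∀ x, x.length ≠ n → O' x = O x) ∧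
      ∀ x, x.length = n → Good O' x := by
    intro n O hO
    choose σ t qs hE ht hx using h O fun q => .inl (hO q)
    classical
    -- The new answers at length `n` come from runs with the old oracle. These runs ask only shorter
    -- strings, where the two oracles agree, so they are also runs with the new one.
    let O' : Str → Str := fun x =>
      if x.length = n then if unpad x = [] then [] else σ x 0 else O x
    have hO' : ∀ x, PaddedSink x (O' x) := by
      intro x
      simp only [O']
      split_ifs with h1 h2
      · simpa [PaddedSink, h2] using sinkOfDAG_nil
      · exact (hx x (htot x)).1
      · exact hO x
    refine ⟨O', hO', fun x hx => if_neg hx, fun x hn => ⟨hO' x, fun h => by simp [O', hn, h],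
      fun h => ⟨σ x, t x, qs x, (hE x).congr_oracle fun q hq => ?_, ht x, by simp [O', hn, h],
        fun q hq => ((hx x (htot x)).2 q hq).2⟩⟩⟩
    have := ((hx x (htot x)).2 q hq).2
    exact (if_neg (by omega)).symm
  choose imp himp using hstep
  choose O₀ hO₀ using htot
  -- Stage `n` has been improved at all lengths below `n`, in increasing order. The value at `x` is
  -- final from stage `|x| + 1` on, and these final values form the oracle.
  let seq : ℕ → {O : Str → Str // ∀ x, PaddedSink x (O x)} := fun n =>
    Nat.rec ⟨O₀, hO₀⟩ (fun n O => ⟨imp n O.1 O.2, (himp n O.1 O.2).1⟩) n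
  have hseq : ∀ (x : Str) (n : ℕ), x.length < n → (seq n).1 x = (seq (x.length + 1)).1 x := by
    intro x n hn
    induction n, hn using Nat.le_induction with
    | base => rfl
    | succ n hn ih => exact ((himp n (seq n).1 (seq n).2).2.1 x (by omega)).trans ih
  refine ⟨fun x => (seq (x.length + 1)).1 x, fun x => ?_⟩
  obtain ⟨h1, h2, h3⟩ := (himp x.length (seq x.length).1 (seq x.length).2).2.2 x rfl
  refine ⟨h1, h2, fun hx => ?_⟩
  obtain ⟨σ, t, qs, h4, h5, h6, h7⟩ := h3 hx
  -- A query is shorter than `x`, so its answer is already final at stage `|x| + 1`.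
  exact ⟨σ, t, qs, h4.congr_oracle fun q hq => hseq q (x.length + 1) (by have := h7 q hq; omega),
    h5, h6, h7⟩

/-- The interpreter computes the self-consistent oracle. Its work obeys `T(n) ≤ p(n) * (C + T(√n))`,
with `C = stepCost c`, since void queries cost nothing and all others have length at most `√n`. -/
theorem solvableInPolyTime_of_dsr (h : TraditionallyDSR PaddedSink) :
    SolvableInPolyTime PaddedSink := by
  obtain ⟨c, p, h⟩ := h
  obtain ⟨O, hO⟩ := exists_selfOracle h
  -- The factor `stepCost c + 1` is included because `C + n ^ D ≤ (C + 1) * n ^ D`; this leaves a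
  -- product of two powers `n ^ D`.
  obtain ⟨D, hD⟩ := (p * (stepCost c + 1 : ℕ)).exists_eval_le_pow
  have main : ∀ (n : ℕ) (x : Str), x.length = n → Answers c O x (x.length ^ (2 * D) + 1) ∧
      (unpad x ≠ [] → Answers c O x (x.length ^ (2 * D))) := by
    intro n
    induction n using Nat.strong_induction_on with
    | _ n ih =>
    rintro x rfl
    have hvoid : unpad x = [] → Answers c O x 0 := fun hx r =>
      ⟨[[]], by rw [RecState.start, if_pos hx]; exact .refl _ _, by simp [(hO x).2.1 hx]⟩
    have hrec : unpad x ≠ [] → Answers c O x (x.length ^ (2 * D)) := by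
      intro hx r
      have hxl := padLen_of_unpad_ne hx
      have hx2 := two_le_of_padLen hxl
      obtain ⟨σ, t, qs, h1, h2, h3, h4⟩ := (hO x).2.2 hx
      obtain ⟨l', -, h5, h6⟩ := h1.reach (c₀ := c) (w := x.length ^ D) le_rfl le_rfl (fun q hq => by
        by_cases hq0 : unpad q = []
        · exact Answers.mono (w := 0) (fun r =>
            ⟨[[]], by rw [RecState.start, if_pos hq0]; exact .refl _ _, by simp [(hO q).2.1 hq0]⟩)
            (Nat.zero_le _)
        -- Both `|q|` and `|x|` are admissible lengths, so `|q| ^ 2 ≤ |x|` and `|q| ^ (2 * D) ≤ |x|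
        -- ^ D`.
        · refine ((ih q.length (h4 q hq) q rfl).2 hq0).mono ?_
          rw [pow_mul, sq]
          exact Nat.pow_le_pow_left
            (mul_self_le_of_padLen (padLen_of_unpad_ne hq0) hxl (h4 q hq)) D)
        (x :: List.replicate c.bound []) (by simp)
        (Store.input_append_replicate [x] c.bound).symm
      refine ⟨l', ?_, by rw [← h3, h5]; rfl⟩
      rw [RecState.start, if_neg hx]
      refine (h6 [] r).mono ?_
      have h7 := hD x.length hx2
      have h8 : 1 ≤ x.length ^ D := Nat.one_le_pow _ _ (by omega)
      rw [Polynomial.eval_mul, Polynomial.eval_natCast] at h7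
      calc t * (stepCost c + x.length ^ D)
          ≤ p.eval x.length * ((stepCost c + 1) * x.length ^ D) := by
            refine Nat.mul_le_mul h2 ?_
            rw [Nat.add_mul]
            have := Nat.mul_le_mul_left (stepCost c) h8
            omega
        _ = p.eval x.length * (stepCost c + 1 : ℕ) * x.length ^ D := by rw [mul_assoc]
        _ ≤ x.length ^ D * x.length ^ D := Nat.mul_le_mul_right _ h7
        _ = x.length ^ (2 * D) := by rw [← pow_add, two_mul]
    refine ⟨?_, hrec⟩
    by_cases hx : unpad x = []
    · exact (hvoid hx).mono (Nat.zero_le _)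
    · exact (hrec hx).mono (Nat.le_succ _)
  have hstart : PT fun x => RecState.start c x [] := PT.recStart c (by fun_prop) (by fun_prop)
  obtain ⟨ps, hps⟩ := hstart.length_enc_le
  have key : ∀ (x : Str), ∃ l, (∀ i, x.length ^ (2 * D) + 1 ≤ i →
      (RecState.step c)^[i] (RecState.start c x []) = ([], l, [])) ∧ l.getD 0 [] = O x ∧
      ∀ i, RecState.size ((RecState.step c)^[i] (RecState.start c x [])) ≤
        ps.eval x.length + (x.length ^ (2 * D) + 1) := by
    intro x
    obtain ⟨l, ⟨n, hn, h1, h2⟩, h3⟩ := (main _ x rfl).1 []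
    have h4 : ∀ i, n ≤ i → (RecState.step c)^[i] (RecState.start c x []) = ([], l, []) := by
      intro i hi
      obtain ⟨j, rfl⟩ := Nat.exists_eq_add_of_le' hi
      rw [Function.iterate_add_apply, h1]
      exact Function.iterate_fixed rfl j
    have h5 := (RecState.size_le (RecState.start c x [])).trans (hps x)
    rw [enc_str] at h5
    refine ⟨l, fun i hi => h4 i (by omega), h3, fun i => ?_⟩
    rcases le_total i n with hi | hi
    · have := h2 i hi
      omega
    · have := h2 n le_rfl
      rw [h4 i hi, ← h1]
      omega
  let q : Polynomial ℕ := Polynomial.X ^ (2 * D) + 1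
  -- The interpreter runs for a number of steps fixed in advance. By `key`, the state stays
  -- polynomially small throughout, also after the computation has ended.
  have hrun := PT.iterate (n := fun x : Str => q.eval x.length)
    (step := fun t : Str × RecState => RecState.step c t.2)
    (PT.polynomial q (by fun_prop)) hstart ((PT.recStep c).comp PT.snd)
    ⟨11 * (ps + q) + 2, fun x i _ => by
      obtain ⟨l, -, -, h1⟩ := key x
      have h2 := h1 i
      have h3 := RecState.length_enc_le ((RecState.step c)^[i] (RecState.start c x []))
      change (enc ((RecState.step c)^[i] (RecState.start c x []))).length ≤ _
      simp [q, enc_str]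
      omega⟩
  refine ⟨fun x => O x, (PT.congr (PT.getD hrun.snd_comp.fst_comp (PT.const 0) (PT.const []))
    fun x => ?_).polyTimeFun, fun x _ => (hO x).1⟩
  obtain ⟨l, h1, h2, -⟩ := key x
  rw [length_enc_nat]
  change _ = ((RecState.step c)^[q.eval x.length] (RecState.start c x [])).2.1.getD 0 []
  rw [h1 _ (by simp [q]), h2]

/-! ### The theorem -/

theorem PLS_subset_FP (h : SolvableInPolyTime PaddedSink) : PLS ⊆ FP := by
  obtain ⟨A, hA, h⟩ := h
  rintro R ⟨hR, hred⟩
  obtain ⟨f, g, hf, hg, hfg⟩ := paddedSink_plsComplete.2 R ⟨hR, hred⟩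
  exact ⟨hR, fun x => g (A (f x)), (hg.pt.comp (hA.pt.comp hf.pt)).polyTimeFun,
    fun x hx => hfg x hx _ (h (f x) (sinkOfDAG_total _))⟩

/-- The algorithm asks nothing, so it behaves alike under every oracle and the restriction on
queries is vacuous. -/
theorem traditionallyDSR_of_mem_FP {R : SearchProblem} (h : R ∈ FP) : TraditionallyDSR R := by
  obtain ⟨-, A, ⟨c, p, hc⟩, hA⟩ := h
  refine ⟨c, p, fun O _ x => ?_⟩
  obtain ⟨t, ⟨σ, hE, h0⟩, ht⟩ := hc x
  exact ⟨σ, t, [], hE.congr_oracle (by simp), ht, fun hx => ⟨h0 ▸ hA x hx, by simp⟩⟩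

theorem mainTheorem7 :
    (∀ R : SearchProblem, PLSComplete R → TraditionallyDSR R) ↔ PLS = FP := by
  refine ⟨fun h => ?_, fun h R hR => traditionallyDSR_of_mem_FP (h ▸ hR.1)⟩
  exact (PLS_subset_FP (solvableInPolyTime_of_dsr
    (h PaddedSink paddedSink_plsComplete))).antisymm FP_subset_PLS
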